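/- Let $A$ be a finite totally ordered alphabet. A \emph{p-sentence} is a finite sequence $P=(w_1,\dots,w_k)$ of nonempty words in $A$ that weakly decreases in the graded lexicographic order (compare lengths first, then lexicographically); $w\ell(P)=(|w_1|,\dots,|w_k|)$ is its partition of word lengths. A weak sentence is a sequence $K=(K_1,K_2,\dots)$ of words, all but finitely many empty; $\mathrm{sort}(K)$ is the p-sentence obtained by deleting its empty words and sorting. Let $x_{a,i}$ ($a\in A$, $i\ge 1$) be variables in which $x_{a,i}$ and $x_{b,j}$ commute whenever $i\ne j$, with no further relations, and write $x_{a_1\cdots a_r,i}=x_{a_1,i}\cdots x_{a_r,i}$, so that every monomial is uniquely of the form $x_K=x_{K_1,1}x_{K_2,2}\cdots$ for a weak sentence $K$. Let $\mathrm{Sym}_A$ be the space of formal series of bounded degree in these monomials over $\mathbb{Q}$ that are invariant under permutations of the second indices; it has the basis $m_P=\sum_{\mathrm{sort}(K)=P}x_K$ indexed by p-sentences. Let $\mathrm{PSym}_A=\mathbb{Q}[h_w : w \text{ a nonempty word}]$ be the commutative polynomial algebra, with basis $h_P=h_{w_1}\cdots h_{w_k}$, and pair $\mathrm{PSym}_A$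 with $\mathrm{Sym}_A$ by $\langle h_P,m_Q\rangle=\delta_{P,Q}$. For a p-sentence $P$, color the $j$-th box of row $i$ of the diagram of $w\ell(P)$ with the $j$-th color of $w_i$. A \emph{colored semistandard Young tableau} of shape $P$ is a filling of this colored diagram with positive integers, weakly increasing along rows and strictly increasing down columns; its \emph{type} is the weak sentence whose $i$-th word lists the colors of the boxes containing $i$, read from left to right and from the bottom row to the top row. Let $\mathcal{K}_{P,Q}$ be the number of such tableaux of shape $P$ and type $Q$ (with $Q$ extended by empty words). The \emph{colored dual Schur function} is $s^*_P=\sum_Q\mathcal{K}_{P,Q}\,m_Q\in \mathrm{Sym}_A$, the sum over all p-sentences $Q$, and the \emph{colored Schur functions} $s_P\in \mathrm{PSym}_A$ are defined by $\langle s_P,s^*_Q\rangle=\delta_{P,Q}$ for all p-sentences $Q$. Let $\mathrm{Sym}$ be the algebra of symmetric functions over $\mathbb{Q}$ in $x_1,x_2,\dots$, with its monomial functions $m_\lambda$, complete homogeneous functions $h_\lambda$ and Schur functions $s_\lambda=\sum_T x^T$ (the sum over semistandard Young tableaux $T$ of shape $\lambda$). The \emph{uncoloring maps} $\upsilon:\mathrm{Sym}_A\to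 \mathrm{Sym}$ and $\upsilon:\mathrm{PSym}_A\to \mathrm{Sym}$ are the linear maps with $\upsilon(m_P)=m_{w\ell(P)}$ and $\upsilon(h_P)=h_{w\ell(P)}$, respectively. \textbf{Proposition.} If $|A|=1$, then for all p-sentences $P$ and $Q$, $$\upsilon(s^*_P)=s_{w\ell(P)}\qquad\text{and}\qquad \upsilon(s_Q)=s_{w\ell(Q)}.$$ -/

import Mathlib

/-!
Throughout, the variables `x₁, x₂, …` are indexed by `ℕ` starting from `0` (so that the index `i`
stands for `x_{i+1}`), and accordingly the entries of tableaux start from `0`, as they do for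
Mathlib's `SemistandardYoungTableau`.  Partitions are represented by Mathlib's `YoungDiagram`,
the parts of `lam` being the list `lam.rowLens`.  The base field is `ℚ`.
-/

namespace ColoredSym

noncomputable section

/-- The formal power series `∑ c_α x^α`. -/
def ofCoeff (c : (ℕ →₀ ℕ) → ℚ) : MvPowerSeries ℕ ℚ := c

theorem coeff_ofCoeff (c : (ℕ →₀ ℕ) → ℚ) (α : ℕ →₀ ℕ) :
    MvPowerSeries.coeff α (ofCoeff c) = c α := rfl

/-- The algebra `Sym` of symmetric functions over `ℚ`: formal power series of bounded degree in
countably many variables which are invariant under all permutations of the variables. -/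
def Sym : Subalgebra ℚ (MvPowerSeries ℕ ℚ) where
  carrier := {f | (∀ (σ : Equiv.Perm ℕ) (α : ℕ →₀ ℕ),
      MvPowerSeries.coeff (α.equivMapDomain σ) f = MvPowerSeries.coeff α f) ∧
    ∃ n : ℕ, ∀ α : ℕ →₀ ℕ, MvPowerSeries.coeff α f ≠ 0 → α.degree ≤ n}
  mul_mem' := by
    rintro f g ⟨hf, n, hn⟩ ⟨hg, m, hm⟩
    refine ⟨fun σ α => ?_, n + m, fun α hα => ?_⟩
    · rw [MvPowerSeries.coeff_mul, MvPowerSeries.coeff_mul]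
      symm
      have e : ∀ a b : ℕ →₀ ℕ, (a + b).equivMapDomain σ =
          a.equivMapDomain σ + b.equivMapDomain σ := fun a b => by ext; simp
      refine Finset.sum_bij (fun p _ => (p.1.equivMapDomain σ, p.2.equivMapDomain σ)) ?_ ?_ ?_ ?_
      · rintro ⟨a, b⟩ h
        rw [Finset.HasAntidiagonal.mem_antidiagonal] at h ⊢
        simp only [← h, e]
      · rintro ⟨a, b⟩ _ ⟨c, d⟩ _ h
        simp only [Prod.mk.injEq] at h
        have inj : ∀ u v : ℕ →₀ ℕ, u.equivMapDomain σ = v.equivMapDomain σ → u = v := by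
          intro u v huv
          ext i
          simpa using DFunLike.congr_fun huv (σ i)
        rw [inj _ _ h.1, inj _ _ h.2]
      · rintro ⟨a, b⟩ h
        rw [Finset.HasAntidiagonal.mem_antidiagonal] at h
        refine ⟨(a.equivMapDomain σ.symm, b.equivMapDomain σ.symm), ?_, ?_⟩
        · rw [Finset.HasAntidiagonal.mem_antidiagonal]
          ext i
          simpa using DFunLike.congr_fun h (σ i)
        · simp [← Finsupp.equivMapDomain_trans]
      · rintro ⟨a, b⟩ _
        simp only [hf, hg]
    · rw [MvPowerSeries.coeff_mul] at hα
      obtain ⟨⟨a, b⟩, hab, h⟩ := Finset.exists_ne_zero_of_sum_ne_zero hα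
      rw [Finset.HasAntidiagonal.mem_antidiagonal] at hab
      rw [← hab, map_add]
      exact add_le_add (hn _ (left_ne_zero_of_mul h)) (hm _ (right_ne_zero_of_mul h))
  add_mem' := by
    rintro f g ⟨hf, n, hn⟩ ⟨hg, m, hm⟩
    refine ⟨fun σ α => by simp only [map_add, hf, hg], max n m, fun α hα => ?_⟩
    by_cases h : MvPowerSeries.coeff α f = 0
    · exact le_max_of_le_right (hm α fun h' => hα (by simp [h, h']))
    · exact le_max_of_le_left (hn α h)
  algebraMap_mem' := by
    intro r
    have key : ∀ α : ℕ →₀ ℕ, MvPowerSeries.coeff α (algebraMap ℚ (MvPowerSeries ℕ ℚ) r) =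
        if α = 0 then r else 0 := by
      intro α
      rw [MvPowerSeries.algebraMap_apply, Algebra.algebraMap_self, RingHom.id_apply,
        MvPowerSeries.coeff_C]
    refine ⟨fun σ α => ?_, 0, fun α hα => ?_⟩
    · rw [key, key]
      have : α.equivMapDomain σ = 0 ↔ α = 0 := by
        constructor
        · intro h
          ext i
          simpa using DFunLike.congr_fun h (σ i)
        · rintro rfl
          simp
      simp only [this]
    · rw [key] at hα
      have : α = 0 := by
        by_contra h
        simp [h] at hα
      simp [this]

open scoped Classical in
/-- The monomial symmetric function `m_λ`, the sum of all monomials whose nonzero exponents are a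
rearrangement of the parts of `λ`. -/
def monomialSym (lam : YoungDiagram) : Sym :=
  ⟨ofCoeff fun α => if α.support.val.map α = (lam.rowLens : Multiset ℕ) then 1 else 0, by
    refine ⟨fun σ α => ?_, lam.rowLens.sum, fun α hα => ?_⟩
    · have : (α.equivMapDomain σ).support.val.map (α.equivMapDomain σ) =
          α.support.val.map α := by
        have h : (α.equivMapDomain σ).support = α.support.map σ.toEmbedding := by
          ext i
          simp [Finsupp.mem_support_iff, Finset.mem_map_equiv]
        rw [h, Finset.map_val, Multiset.map_map]
        refine Multiset.map_congr rfl fun i _ => ?_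
        simp
      simp only [coeff_ofCoeff, this]
    · have h : α.support.val.map α = (lam.rowLens : Multiset ℕ) := by
        by_contra h
        simp [coeff_ofCoeff, h] at hα
      rw [← Multiset.sum_coe, ← h]
      exact le_refl _⟩

/-- The complete homogeneous symmetric function `h_n`, the sum of all monomials of degree `n`. -/
def completeSym (n : ℕ) : Sym :=
  ⟨ofCoeff fun α => if α.degree = n then 1 else 0, by
    refine ⟨fun σ α => ?_, n, fun α hα => ?_⟩
    · have : (α.equivMapDomain σ).degree = α.degree := by
        have h : (α.equivMapDomain σ).support = α.support.map σ.toEmbedding := by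
          ext i
          simp [Finsupp.mem_support_iff, Finset.mem_map_equiv]
        rw [Finsupp.degree_apply, Finsupp.degree_apply, h, Finset.sum_map]
        simp
      simp only [coeff_ofCoeff, this]
    · by_contra h
      have h' : α.degree ≠ n := by omega
      simp [coeff_ofCoeff, h'] at hα⟩

/-- `h_λ = h_{λ₁} ⋯ h_{λ_k}`. -/
def completeSymPart (lam : YoungDiagram) : Sym := (lam.rowLens.map completeSym).prod

/-- The exponent of the monomial `x^T`: the number of times each integer is an entry of `T`. -/
def content {lam : YoungDiagram} (T : SemistandardYoungTableau lam) : ℕ →₀ ℕ :=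
  ∑ c ∈ lam.cells, Finsupp.single (T c.1 c.2) 1

/-- The classical Schur function `s_λ = ∑_T x^T`, the sum over all semistandard Young tableaux of
shape `λ`: the coefficient of `x^α` is the number of such tableaux with `x^T = x^α`. -/
def schur (lam : YoungDiagram) : MvPowerSeries ℕ ℚ :=
  ofCoeff fun α => (Nat.card {T : SemistandardYoungTableau lam // content T = α} : ℚ)

/-! ### Words and sentences -/

/-- Nonempty words in the alphabet `A`. -/
@[ext]
structure Word (A : Type*) where
  /-- The colors of the word. -/
  toList : List A
  /-- The word is nonempty. -/
  ne_nil : toList ≠ []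

variable {A : Type*}

/-- The size of a word. -/
def Word.length (w : Word A) : ℕ := w.toList.length

variable [LinearOrder A]

/-- Graded lexicographic order: first compare lengths, then compare lexicographically. -/
instance : LinearOrder (Word A) :=
  LinearOrder.lift' (fun w : Word A => (toLex (w.toList.length, w.toList) : ℕ ×ₗ List A))
    fun _ _ h => Word.ext (Prod.ext_iff.1 (toLex.injective h)).2

theorem Word.length_mono {v w : Word A} (h : v ≤ w) : v.length ≤ w.length := by
  have h' : (toLex (v.toList.length, v.toList) : ℕ ×ₗ List A) ≤
    toLex (w.toList.length, w.toList) := h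
  rw [Prod.Lex.le_iff] at h'
  rcases h' with h' | h'
  · exact le_of_lt h'
  · exact le_of_eq h'.1

/-- p-sentences: finite sequences of nonempty words that weakly decrease in the graded
lexicographic order. -/
@[ext]
structure PSent (A : Type*) [LinearOrder A] where
  /-- The words of the p-sentence. -/
  words : List (Word A)
  /-- The words weakly decrease. -/
  sorted : words.SortedGE

/-- The size of a p-sentence. -/
def PSent.size (P : PSent A) : ℕ := (P.words.map Word.length).sum

/-- The partition `wℓ(P)` of word lengths of a p-sentence. -/
def PSent.shape (P : PSent A) : YoungDiagram :=
  YoungDiagram.ofRowLens (P.words.map Word.length) <| by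
    rw [List.sortedGE_iff_pairwise, List.pairwise_map]
    exact (List.sortedGE_iff_pairwise.1 P.sorted).imp fun h => Word.length_mono h

/-- Weak sentences (infinite sequences of words, all but finitely many empty).  The weak sentence
`K` stands for the monomial `x_{K₁,1} x_{K₂,2} ⋯` in the partially commuting variables `x_{a,i}`:
every monomial has a unique expression of this form, and monomials are multiplied by concatenating
words with the same index. -/
abbrev WSent (A : Type*) : Type _ := ℕ →₀ FreeAddMonoid A

/-- The size of a weak sentence, that is, the degree of the monomial it stands for. -/
def WSent.size (K : WSent A) : ℕ := K.sum fun _ w => w.length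

/-- The multiset of nonempty words of a weak sentence. -/
def WSent.words (K : WSent A) : Multiset (Word A) :=
  K.support.attach.val.map fun i =>
    ⟨FreeAddMonoid.toList (K i.1), fun h => Finsupp.mem_support_iff.1 i.2
      (FreeAddMonoid.toList.injective h)⟩

/-- The p-sentence obtained by sorting a multiset of nonempty words. -/
def PSent.ofMultiset (s : Multiset (Word A)) : PSent A :=
  ⟨s.sort (· ≥ ·), List.sortedGE_iff_pairwise.2 (Multiset.pairwise_sort _ _)⟩

/-- The p-sentence `sort(K)` obtained by deleting the empty words of `K` and sorting. -/
def WSent.sort (K : WSent A) : PSent A := PSent.ofMultiset K.words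

/-- A p-sentence `(w₁, …, w_k)` as the weak sentence `(w₁, …, w_k, ∅, ∅, …)`. -/
def PSent.toWSent (P : PSent A) : WSent A :=
  Finsupp.onFinset (Finset.range P.words.length)
    (fun i => if h : i < P.words.length then FreeAddMonoid.ofList P.words[i].toList else 0) <| by
      intro i hi
      by_contra h
      rw [Finset.mem_range] at h
      simp [h] at hi

/-! ### Sorting and permuting -/

theorem PSent.coe_ofMultiset (s : Multiset (Word A)) :
    ((ofMultiset s).words : Multiset (Word A)) = s :=
  Multiset.sort_eq _ _

theorem PSent.ofMultiset_coe (P : PSent A) : ofMultiset (P.words : Multiset (Word A)) = P :=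
  PSent.ext <| (Multiset.coe_eq_coe.1 (coe_ofMultiset _)).eq_of_sortedGE (ofMultiset _).sorted
    P.sorted

theorem WSent.count_words (K : WSent A) (w : Word A) :
    K.words.count w = Nat.card {i : ℕ // FreeAddMonoid.toList (K i) = w.toList} := by
  classical
  rw [WSent.words, Multiset.count_map, ← Finset.filter_val, Finset.card_val,
    ← Nat.card_eq_finsetCard]
  refine Nat.card_congr ⟨fun x => ⟨x.1.1, ?_⟩, fun i => ⟨⟨i.1, ?_⟩, ?_⟩, ?_, ?_⟩
  · have := (Finset.mem_filter.1 x.2).2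
    exact (congrArg Word.toList this).symm
  · rw [Finsupp.mem_support_iff]
    intro h
    have h' := i.2
    rw [h] at h'
    exact w.ne_nil h'.symm
  · rw [Finset.mem_filter]
    exact ⟨Finset.mem_attach _ _, Word.ext i.2.symm⟩
  · intro x
    rfl
  · intro x
    rfl

theorem PSent.words_toWSent (P : PSent A) : P.toWSent.words = (P.words : Multiset (Word A)) := by
  classical
  ext w
  have h : (P.words : Multiset (Word A)) =
      (Finset.univ : Finset (Fin P.words.length)).val.map P.words.get := by
    rw [Fin.univ_val_map, List.ofFn_get]
  rw [WSent.count_words, h, Multiset.count_map, ← Finset.filter_val, Finset.card_val,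
    ← Nat.card_eq_finsetCard]
  have key : ∀ i : ℕ, FreeAddMonoid.toList (P.toWSent i) = w.toList ↔
      ∃ h : i < P.words.length, P.words[i] = w := by
    intro i
    rw [PSent.toWSent, Finsupp.onFinset_apply]
    split_ifs with hi
    · rw [FreeAddMonoid.toList_ofList]
      exact ⟨fun e => ⟨hi, Word.ext e⟩, fun ⟨_, e⟩ => congrArg Word.toList e⟩
    · exact ⟨fun e => absurd e.symm w.ne_nil, fun ⟨e, _⟩ => absurd e hi⟩
  refine Nat.card_congr ⟨fun i => ⟨⟨i.1, ((key _).1 i.2).1⟩, ?_⟩, fun x => ⟨x.1.1, ?_⟩, ?_, ?_⟩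
  · rw [Finset.mem_filter]
    exact ⟨Finset.mem_univ _, ((key _).1 i.2).2.symm⟩
  · exact (key _).2 ⟨x.1.2, (Finset.mem_filter.1 x.2).2.symm⟩
  · intro x
    rfl
  · intro x
    rfl

theorem PSent.sort_toWSent (P : PSent A) : P.toWSent.sort = P := by
  rw [WSent.sort, PSent.words_toWSent, PSent.ofMultiset_coe]

theorem PSent.toWSent_injective : Function.Injective (PSent.toWSent (A := A)) :=
  Function.LeftInverse.injective PSent.sort_toWSent

theorem WSent.size_sort (K : WSent A) : K.sort.size = K.size := by
  have h : K.sort.size = ((K.sort.words : Multiset (Word A)).map Word.length).sum := by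
    simp [PSent.size]
  rw [h, WSent.sort, PSent.coe_ofMultiset, WSent.words, Multiset.map_map, WSent.size,
    Finsupp.sum, ← Finset.sum_attach]
  rfl

theorem PSent.size_toWSent (P : PSent A) : P.toWSent.size = P.size := by
  rw [← WSent.size_sort, PSent.sort_toWSent]

theorem WSent.sort_equivMapDomain (K : WSent A) (σ : Equiv.Perm ℕ) :
    WSent.sort (K.equivMapDomain σ) = K.sort := by
  classical
  rw [WSent.sort, WSent.sort]
  congr 1
  ext w
  rw [WSent.count_words, WSent.count_words]
  refine Nat.card_congr (σ.symm.subtypeEquiv fun i => ?_)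
  rw [Finsupp.equivMapDomain_apply]

theorem WSent.exists_perm {K L : WSent A} (h : K.sort = L.sort) :
    ∃ σ : Equiv.Perm ℕ, L = K.equivMapDomain σ := by
  classical
  have hw : K.words = L.words := by
    rw [← PSent.coe_ofMultiset K.words, ← PSent.coe_ofMultiset L.words]
    exact congrArg _ (congrArg PSent.words h)
  have fin : ∀ (M : WSent A) (c : FreeAddMonoid A), c ≠ 0 → Finite {i // M i = c} := by
    intro M c hc
    refine Set.Finite.subset M.support.finite_toSet fun i hi => ?_
    rw [Finset.mem_coe, Finsupp.mem_support_iff, show M i = c from hi]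
    exact hc
  have inf : ∀ M : WSent A, Infinite {i // M i = 0} := by
    intro M
    refine Set.infinite_coe_iff.2 ?_
    have : {i | M i = 0} = (M.support : Set ℕ)ᶜ := by
      ext i
      simp
    change Set.Infinite {i | M i = 0}
    rw [this]
    exact M.support.finite_toSet.infinite_compl
  have e : ∀ c : FreeAddMonoid A, Nonempty ({i // K i = c} ≃ {i // L i = c}) := by
    intro c
    by_cases hc : c = 0
    · subst hc
      have := inf K
      have := inf L
      exact nonempty_equiv_of_countable
    · have := fin K c hc
      have := fin L c hc
      rw [← Finite.card_eq]
      have h1 := WSent.count_words K ⟨FreeAddMonoid.toList c, fun h' => hc h'⟩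
      rw [hw, WSent.count_words] at h1
      exact h1.symm
  refine ⟨Equiv.ofFiberEquiv fun c => (e c).some, ?_⟩
  ext1 i
  rw [Finsupp.equivMapDomain_apply]
  have := Equiv.ofFiberEquiv_map (fun c => (e c).some)
    ((Equiv.ofFiberEquiv fun c => (e c).some).symm i)
  rwa [Equiv.apply_symm_apply] at this

theorem PSent.finite_size_le [Finite A] (n : ℕ) : {P : PSent A | P.size ≤ n}.Finite := by
  have fin : Finite {w : Word A // w.length ≤ n} := by
    refine Set.Finite.of_injOn (f := Word.toList) (t := {l : List A | l.length ≤ n})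
      (fun w hw => hw) (fun v _ w _ h => Word.ext h) (List.finite_length_le A n)
  have h : ∀ P : PSent A, P.size ≤ n → ∀ w ∈ P.words, w.length ≤ n := fun P hP w hw =>
    (List.single_le_sum (by simp) _ (List.mem_map_of_mem hw)).trans hP
  have h' : ∀ P : PSent A, P.size ≤ n → P.words.length ≤ n := by
    intro P hP
    refine le_trans ?_ hP
    have := List.length_le_sum_of_one_le (P.words.map Word.length) (by
      intro i hi
      obtain ⟨w, -, rfl⟩ := List.mem_map.1 hi
      exact List.length_pos_iff.2 w.ne_nil)
    rwa [List.length_map] at this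
  refine Set.Finite.of_finite_image (f := PSent.words) ?_ fun P _ Q _ h => PSent.ext h
  refine ((List.finite_length_le {w : Word A // w.length ≤ n} n).image
    (List.map Subtype.val)).subset ?_
  rintro _ ⟨P, hP, rfl⟩
  refine ⟨P.words.attachWith _ (h P hP), ?_, ?_⟩
  · simpa using h' P hP
  · simp

/-! ### The colored symmetric functions -/

/-- The space `Sym_A` of colored symmetric functions: formal series `∑_K f(K) x_K` of bounded
degree in the monomials in the partially commuting variables, invariant under all permutations of
the second indices of the variables. -/
def SymA (A : Type*) [LinearOrder A] : Submodule ℚ (WSent A → ℚ) where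
  carrier := {f | (∀ (σ : Equiv.Perm ℕ) (K : WSent A), f (K.equivMapDomain σ) = f K) ∧
    ∃ n : ℕ, ∀ K : WSent A, f K ≠ 0 → K.size ≤ n}
  add_mem' := by
    rintro f g ⟨hf, n, hn⟩ ⟨hg, m, hm⟩
    refine ⟨fun σ K => by simp only [Pi.add_apply, hf, hg], max n m, fun K hK => ?_⟩
    by_cases h : f K = 0
    · exact le_max_of_le_right (hm K fun h' => hK (by simp [h, h']))
    · exact le_max_of_le_left (hn K h)
  zero_mem' := ⟨fun _ _ => rfl, 0, fun _ h => absurd rfl h⟩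
  smul_mem' := by
    rintro c f ⟨hf, n, hn⟩
    refine ⟨fun σ K => by simp only [Pi.smul_apply, hf], n, fun K hK => hn K fun h => hK ?_⟩
    simp [h]

open scoped Classical in
/-- The colored monomial symmetric function `m_P = ∑_{sort(K) = P} x_K`. -/
def monomialA (P : PSent A) : SymA A :=
  ⟨fun K => if K.sort = P then 1 else 0, by
    refine ⟨fun σ K => by simp only [WSent.sort_equivMapDomain], P.size, fun K hK => ?_⟩
    by_contra h
    refine hK (if_neg ?_)
    rintro rfl
    exact h K.size_sort.ge⟩

/-- The basis `{m_P}` of `Sym_A`; see `monomialBasis_apply`. -/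
def monomialBasis (A : Type*) [LinearOrder A] [Finite A] : Module.Basis (PSent A) ℚ (SymA A) :=
  .ofRepr
    { toFun := fun f => Finsupp.ofSupportFinite (fun P => f.1 P.toWSent) <| by
        obtain ⟨n, hn⟩ := f.2.2
        refine (PSent.finite_size_le n).subset fun P hP => ?_
        rw [Set.mem_ofPred_eq, ← PSent.size_toWSent]
        exact hn _ hP
      map_add' := fun f g => by
        ext P
        rfl
      map_smul' := fun c f => by
        ext P
        rfl
      invFun := fun g => ⟨fun K => g K.sort, by
        refine ⟨fun σ K => by simp only [WSent.sort_equivMapDomain],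
          g.support.sup PSent.size, fun K hK => ?_⟩
        rw [← WSent.size_sort]
        exact Finset.le_sup (f := PSent.size) (Finsupp.mem_support_iff.2 hK)⟩
      left_inv := fun f => by
        ext K
        obtain ⟨σ, hσ⟩ := WSent.exists_perm (K := K) (L := K.sort.toWSent)
          (by rw [PSent.sort_toWSent])
        change f.1 K.sort.toWSent = f.1 K
        rw [hσ, f.2.1]
      right_inv := fun g => by
        ext P
        change g P.toWSent.sort = g P
        rw [PSent.sort_toWSent] }

theorem monomialBasis_apply [Finite A] (P : PSent A) : monomialBasis A P = monomialA P := by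
  classical
  ext K
  change (Finsupp.single P (1 : ℚ)) K.sort = if K.sort = P then 1 else 0
  rw [Finsupp.single_apply]
  simp only [eq_comm]

/-! ### The algebra of p-sentences and the duality pairing -/

/-- The algebra `PSym_A = ℚ[h_w : w a nonempty word]`. -/
abbrev PSymA (A : Type*) : Type _ := MvPolynomial (Word A) ℚ

/-- The colored complete homogeneous function `h_P = h_{w₁} ⋯ h_{w_k}`. -/
def completeA (P : PSent A) : PSymA A := (P.words.map MvPolynomial.X).prod

open scoped Classical in
/-- The basis `{h_P}` of `PSym_A`; see `completeBasis_apply`. -/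
def completeBasis (A : Type*) [LinearOrder A] : Module.Basis (PSent A) ℚ (PSymA A) :=
  (MvPolynomial.basisMonomials (Word A) ℚ).reindex
    { toFun := fun d => PSent.ofMultiset (Finsupp.toMultiset d)
      invFun := fun P => Multiset.toFinsupp (P.words : Multiset (Word A))
      left_inv := fun d => by simp [PSent.coe_ofMultiset]
      right_inv := fun P => by simp [PSent.ofMultiset_coe] }

theorem completeBasis_apply (P : PSent A) : completeBasis A P = completeA P := by
  classical
  have h : ∀ s : Multiset (Word A), MvPolynomial.monomial (Multiset.toFinsupp s) (1 : ℚ) =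
      (s.map MvPolynomial.X).prod := by
    intro s
    induction s using Multiset.induction_on with
    | empty => simp
    | cons w s ih =>
      rw [Multiset.map_cons, Multiset.prod_cons, ← ih, MvPolynomial.X, MvPolynomial.monomial_mul,
        ← Multiset.singleton_add, map_add, Multiset.toFinsupp_singleton, one_mul]
  rw [completeBasis, Module.Basis.reindex_apply, MvPolynomial.coe_basisMonomials]
  simp only [Equiv.coe_fn_symm_mk]
  rw [h, completeA, Multiset.map_coe, Multiset.prod_coe]

/-- The bilinear pairing `PSym_A × Sym_A → ℚ` with `⟨h_P, m_Q⟩ = δ_{P,Q}`; see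
`pairing_completeA_monomialA`. -/
def pairing (A : Type*) [LinearOrder A] [Finite A] : PSymA A →ₗ[ℚ] SymA A →ₗ[ℚ] ℚ :=
  (completeBasis A).constr ℚ fun P => (monomialBasis A).coord P

open scoped Classical in
theorem pairing_completeA_monomialA [Finite A] (P Q : PSent A) :
    pairing A (completeA P) (monomialA Q) = if P = Q then 1 else 0 := by
  rw [← completeBasis_apply, pairing, Module.Basis.constr_basis, ← monomialBasis_apply,
    Module.Basis.coord_apply, Module.Basis.repr_self, Finsupp.single_apply]
  simp only [eq_comm]

/-- The uncoloring map `υ : Sym_A → Sym`, the linear map with `υ(m_P) = m_{wℓ(P)}`. -/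
def uncolorSymA (A : Type*) [LinearOrder A] [Finite A] : SymA A →ₗ[ℚ] Sym :=
  (monomialBasis A).constr ℚ fun P => monomialSym P.shape

/-- The uncoloring map `υ : PSym_A → Sym`, the linear map with `υ(h_P) = h_{wℓ(P)}`. -/
def uncolorPSymA (A : Type*) [LinearOrder A] : PSymA A →ₗ[ℚ] Sym :=
  (completeBasis A).constr ℚ fun P => completeSymPart P.shape

/-! ### Colored tableaux -/

/-- The boxes of the colored diagram of shape `P` with their colors: the `j`-th box of row `i` has
the `j`-th color of the `i`-th word.  The boxes are listed row by row from the bottom row to the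
top row, and from left to right in each row. -/
def PSent.boxes (P : PSent A) : List ((ℕ × ℕ) × A) :=
  P.words.zipIdx.reverse.flatMap fun p =>
    p.1.toList.zipIdx.map fun q => ((p.2, q.2), q.1)

/-- Colored semistandard Young tableaux of shape `P`: semistandard fillings of the diagram of
`P`, the coloring of which is determined by `P`. -/
abbrev CSSYT (P : PSent A) : Type := SemistandardYoungTableau P.shape

/-- The `i`-th word of the type of `T`: the colors of the boxes containing `i`, read from left to
right and from bottom to top. -/
def typeWord {P : PSent A} (T : CSSYT P) (i : ℕ) : List A :=
  (P.boxes.filter fun b => T b.1.1 b.1.2 = i).map Prod.snd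

/-- The type of a colored semistandard Young tableau. -/
def CSSYT.type {P : PSent A} (T : CSSYT P) : WSent A :=
  Finsupp.onFinset (P.boxes.map fun b => T b.1.1 b.1.2).toFinset
    (fun i => FreeAddMonoid.ofList (typeWord T i)) <| by
      intro i hi
      by_contra h
      refine hi ?_
      have : typeWord T i = [] := by
        rw [typeWord, List.map_eq_nil_iff, List.filter_eq_nil_iff]
        intro b hb hbi
        refine h (List.mem_toFinset.2 (List.mem_map.2 ⟨b, hb, ?_⟩))
        simpa using hbi
      rw [this]
      rfl

/-- The colored Kostka number `K_{P,B}`: the number of colored semistandard Young tableaux of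
shape `P` and type `B`. -/
def coloredKostka (P : PSent A) (B : WSent A) : ℕ := Nat.card {T : CSSYT P // CSSYT.type T = B}

theorem PSent.mem_boxes (P : PSent A) (i j : ℕ) (a : A) : ((i, j), a) ∈ P.boxes ↔
    ∃ w, P.words[i]? = some w ∧ w.toList[j]? = some a := by
  simp only [PSent.boxes, List.mem_flatMap, List.mem_reverse, List.mem_map, Prod.mk.injEq]
  constructor
  · rintro ⟨⟨w, i'⟩, hp, ⟨a', j'⟩, hq, ⟨rfl, rfl⟩, rfl⟩
    exact ⟨w, List.mem_zipIdx_iff_getElem?.1 hp, List.mem_zipIdx_iff_getElem?.1 hq⟩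
  · rintro ⟨w, h1, h2⟩
    exact ⟨(w, i), List.mem_zipIdx_iff_getElem?.2 h1, (a, j), List.mem_zipIdx_iff_getElem?.2 h2,
      ⟨rfl, rfl⟩, rfl⟩

theorem PSent.mem_shape (P : PSent A) (i j : ℕ) :
    (i, j) ∈ P.shape ↔ ∃ a, ((i, j), a) ∈ P.boxes := by
  simp only [PSent.mem_boxes, PSent.shape, YoungDiagram.mem_ofRowLens, List.length_map,
    List.getElem_map, Word.length]
  constructor
  · rintro ⟨h1, h2⟩
    exact ⟨_, _, List.getElem?_eq_getElem h1, List.getElem?_eq_getElem h2⟩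
  · rintro ⟨a, w, h1, h2⟩
    obtain ⟨h3, rfl⟩ := List.getElem?_eq_some_iff.1 h1
    exact ⟨h3, (List.getElem?_eq_some_iff.1 h2).1⟩

theorem CSSYT.sum_type {P : PSent A} (T : CSSYT P) (f : ℕ → ℕ) :
    (P.boxes.map fun b => f (T b.1.1 b.1.2)).sum =
      (CSSYT.type T).sum fun i w => f i * w.length := by
  classical
  rw [CSSYT.type, Finsupp.onFinset_sum _ (by intro i; simp)]
  have h := Finset.sum_list_map_count (P.boxes.map fun b => T b.1.1 b.1.2) f
  rw [List.map_map] at h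
  refine h.trans (Finset.sum_congr rfl fun i _ => ?_)
  rw [smul_eq_mul, mul_comm]
  congr 1
  rw [List.count_eq_countP, List.countP_map, List.countP_eq_length_filter]
  change _ = (typeWord T i).length
  rw [typeWord, List.length_map]
  rfl

theorem CSSYT.size_type {P : PSent A} (T : CSSYT P) : (CSSYT.type T).size = P.boxes.length := by
  have h := CSSYT.sum_type T fun _ => 1
  simp only [one_mul, List.map_const', List.sum_replicate, smul_eq_mul, mul_one] at h
  exact h.symm

theorem CSSYT.le_entry {P : PSent A} (T : CSSYT P) {i j : ℕ} (h : (i, j) ∈ P.shape) :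
    i ≤ T i j := by
  induction i with
  | zero => exact Nat.zero_le _
  | succ i ih =>
    have h1 := ih (P.shape.up_left_mem (Nat.le_succ i) le_rfl h)
    have h2 := T.col_strict (Nat.lt_add_one i) h
    omega

theorem CSSYT.type_highestWeight (P : PSent A) :
    CSSYT.type (SemistandardYoungTableau.highestWeight P.shape) = P.toWSent := by
  have key : ∀ (l : List (Word A)) (k i : ℕ),
      (((l.zipIdx k).reverse.flatMap fun p => p.1.toList.zipIdx.map fun q =>
        (((p.2, q.2), q.1) : (ℕ × ℕ) × A)).filter fun b => b.1.1 = i).map Prod.snd =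
      if h : k ≤ i ∧ i - k < l.length then l[i - k].toList else [] := by
    intro l
    induction l with
    | nil => simp
    | cons w l ih =>
      intro k i
      rw [List.zipIdx_cons, List.reverse_cons, List.flatMap_append, List.filter_append,
        List.map_append, ih]
      simp only [List.flatMap_cons, List.flatMap_nil, List.append_nil, List.filter_map,
        List.map_map, Function.comp_def]
      by_cases hk : k = i
      · subst hk
        simp
      · have hd : ∀ h : k ≤ i ∧ i - k < (w :: l).length, ∃ h' : k + 1 ≤ i ∧ i - (k + 1) < l.length,
            (w :: l)[i - k] = l[i - (k + 1)] := by
          intro h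
          have hl : i - (k + 1) < l.length := by
            have := h.2
            rw [List.length_cons] at this
            omega
          refine ⟨⟨by omega, hl⟩, ?_⟩
          have : i - k = (i - (k + 1)) + 1 := by omega
          simp only [this, List.getElem_cons_succ]
        simp only [hk, decide_false, List.filter_false, List.map_nil, List.append_nil]
        split_ifs with h1 h2 h2
        · rw [(hd h2).2]
        · refine absurd ⟨by omega, ?_⟩ h2
          rw [List.length_cons]
          omega
        · exact absurd (hd h2).1 h1
        · rfl
  ext1 i
  change FreeAddMonoid.ofList (typeWord _ i) = _
  have h1 : typeWord (SemistandardYoungTableau.highestWeight P.shape) i =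
      (P.boxes.filter fun b => b.1.1 = i).map Prod.snd := by
    rw [typeWord]
    congr 1
    refine List.filter_congr fun b hb => ?_
    have : (b.1.1, b.1.2) ∈ P.shape := (P.mem_shape _ _).2 ⟨b.2, hb⟩
    simp [SemistandardYoungTableau.highestWeight_apply, this]
  rw [h1, PSent.boxes, key, PSent.toWSent, Finsupp.onFinset_apply]
  simp only [Nat.zero_le, Nat.sub_zero, true_and]
  split_ifs <;> rfl

/-- The statistic `∑ i |w_i|` on p-sentences, for which the colored Kostka matrix is triangular. -/
def PSent.rank (P : PSent A) : ℕ := P.toWSent.sum fun i w => i * w.length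

theorem PSent.rank_eq (P : PSent A) : P.rank = (P.boxes.map fun b => b.1.1).sum := by
  rw [PSent.rank, ← CSSYT.type_highestWeight]
  rw [← CSSYT.sum_type _ (fun i => i)]
  congr 1
  refine List.map_congr_left fun b hb => ?_
  have : (b.1.1, b.1.2) ∈ P.shape := (P.mem_shape _ _).2 ⟨b.2, hb⟩
  simp [SemistandardYoungTableau.highestWeight_apply, this]

theorem CSSYT.rank_lt_or_eq {P Q : PSent A} (T : CSSYT P) (h : CSSYT.type T = Q.toWSent) :
    P.rank < Q.rank ∨ (P = Q ∧ T = SemistandardYoungTableau.highestWeight P.shape) := by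
  have hQ : Q.rank = (P.boxes.map fun b => T b.1.1 b.1.2).sum := by
    rw [PSent.rank, ← h, ← CSSYT.sum_type T fun i => i]
  have hle : ∀ b ∈ P.boxes, b.1.1 ≤ T b.1.1 b.1.2 := fun b hb =>
    CSSYT.le_entry T ((P.mem_shape _ _).2 ⟨b.2, hb⟩)
  by_cases hb : ∀ b ∈ P.boxes, b.1.1 = T b.1.1 b.1.2
  · right
    have hT : T = SemistandardYoungTableau.highestWeight P.shape := by
      ext i j
      by_cases hc : (i, j) ∈ P.shape
      · obtain ⟨a, ha⟩ := (P.mem_shape i j).1 hc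
        rw [SemistandardYoungTableau.highestWeight_apply, if_pos hc]
        exact (hb _ ha).symm
      · rw [T.zeros hc, SemistandardYoungTableau.zeros _ hc]
    refine ⟨PSent.toWSent_injective ?_, hT⟩
    rw [← h, hT, CSSYT.type_highestWeight]
  · left
    push Not at hb
    obtain ⟨b, hb, hne⟩ := hb
    rw [hQ, PSent.rank_eq]
    exact List.sum_lt_sum _ _ hle ⟨b, hb, lt_of_le_of_ne (hle b hb) hne⟩

theorem exists_of_coloredKostka_ne_zero {P : PSent A} {B : WSent A} (h : coloredKostka P B ≠ 0) :
    ∃ T : CSSYT P, CSSYT.type T = B := by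
  by_contra hT
  push Not at hT
  refine h ?_
  have : IsEmpty {T : CSSYT P // CSSYT.type T = B} := ⟨fun T => hT T.1 T.2⟩
  exact Nat.card_of_isEmpty

theorem coloredKostka_triangular {P Q : PSent A} (h : coloredKostka P Q.toWSent ≠ 0) :
    P.rank < Q.rank ∨ P = Q := by
  obtain ⟨T, hT⟩ := exists_of_coloredKostka_ne_zero h
  exact (CSSYT.rank_lt_or_eq T hT).imp_right And.left

theorem coloredKostka_self (P : PSent A) : coloredKostka P P.toWSent = 1 := by
  rw [coloredKostka, Nat.card_eq_one_iff_unique]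
  refine ⟨⟨fun S T => Subtype.ext ?_⟩, ⟨⟨_, CSSYT.type_highestWeight P⟩⟩⟩
  have h : ∀ T : {T : CSSYT P // CSSYT.type T = P.toWSent},
      T.1 = SemistandardYoungTableau.highestWeight P.shape := fun T =>
    ((CSSYT.rank_lt_or_eq T.1 T.2).resolve_left (lt_irrefl _)).2
  rw [h S, h T]

theorem size_eq_of_coloredKostka_ne_zero {P Q : PSent A} (h : coloredKostka P Q.toWSent ≠ 0) :
    Q.size = P.size := by
  obtain ⟨T, hT⟩ := exists_of_coloredKostka_ne_zero h
  rw [← PSent.size_toWSent, ← PSent.size_toWSent, ← hT, ← CSSYT.type_highestWeight P,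
    CSSYT.size_type, CSSYT.size_type]

theorem finite_coloredKostka [Finite A] (P : PSent A) :
    {Q : PSent A | coloredKostka P Q.toWSent ≠ 0}.Finite :=
  (PSent.finite_size_le P.size).subset fun _ h => (size_eq_of_coloredKostka_ne_zero h).le

theorem finite_coloredKostka_left [Finite A] (Q : PSent A) :
    {P : PSent A | coloredKostka P Q.toWSent ≠ 0}.Finite :=
  (PSent.finite_size_le Q.size).subset fun _ h => (size_eq_of_coloredKostka_ne_zero h).ge

/-! ### Colored dual Schur functions and colored Schur functions -/

/-- The colored dual Schur function `s*_P = ∑_Q K_{P,Q} m_Q`, the sum over all p-sentences `Q`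
(it has finitely many nonzero terms by `finite_coloredKostka`). -/
def coloredDualSchur (P : PSent A) : SymA A :=
  ∑ᶠ Q : PSent A, (coloredKostka P Q.toWSent : ℚ) • monomialA Q

theorem pairing_completeA_coloredDualSchur [Finite A] (R P : PSent A) :
    pairing A (completeA R) (coloredDualSchur P) = coloredKostka P R.toWSent := by
  classical
  rw [coloredDualSchur, map_finsum]
  · rw [finsum_eq_single _ R]
    · rw [map_smul, pairing_completeA_monomialA, if_pos rfl, smul_eq_mul, mul_one]
    · intro Q hQ
      rw [map_smul, pairing_completeA_monomialA, if_neg hQ.symm, smul_zero]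
  · refine (finite_coloredKostka P).subset fun Q hQ h => hQ ?_
    simp only [h, Nat.cast_zero, zero_smul]

open scoped Classical in
theorem existsUnique_coloredSchur [Finite A] (P : PSent A) :
    ∃! f : PSymA A, ∀ Q : PSent A,
      pairing A f (coloredDualSchur Q) = if P = Q then 1 else 0 := by
  have ex : ∀ (n : ℕ) (P : PSent A), P.rank = n → ∃ f : PSymA A, ∀ Q : PSent A,
      pairing A f (coloredDualSchur Q) = if P = Q then 1 else 0 := by
    intro n
    induction n using Nat.strong_induction_on with
    | _ n ih =>
      rintro P rfl
      have ih' : ∀ R : PSent A, ∃ f : PSymA A, R.rank < P.rank → ∀ Q : PSent A,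
          pairing A f (coloredDualSchur Q) = if R = Q then 1 else 0 := by
        intro R
        by_cases hR : R.rank < P.rank
        · obtain ⟨f, hf⟩ := ih _ hR R rfl
          exact ⟨f, fun _ => hf⟩
        · exact ⟨0, fun h => absurd h hR⟩
      choose s hs using ih'
      refine ⟨completeA P - ∑ R ∈ (finite_coloredKostka_left P).toFinset.erase P,
        (coloredKostka R P.toWSent : ℚ) • s R, fun Q => ?_⟩
      rw [map_sub, LinearMap.sub_apply, pairing_completeA_coloredDualSchur, map_sum,
        LinearMap.sum_apply]
      have h : ∀ R ∈ (finite_coloredKostka_left P).toFinset.erase P,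
          pairing A ((coloredKostka R P.toWSent : ℚ) • s R) (coloredDualSchur Q) =
            if R = Q then (coloredKostka Q P.toWSent : ℚ) else 0 := by
        intro R hR
        rw [Finset.mem_erase, Set.Finite.mem_toFinset] at hR
        have := (coloredKostka_triangular hR.2).resolve_right hR.1
        rw [map_smul, LinearMap.smul_apply, hs R this Q]
        by_cases hRQ : R = Q
        · subst hRQ
          simp
        · simp [hRQ]
      rw [Finset.sum_congr rfl h, Finset.sum_ite_eq']
      by_cases hPQ : P = Q
      · subst hPQ
        simp [coloredKostka_self]
      · rw [if_neg hPQ]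
        split_ifs with hm
        · exact sub_self _
        · rw [Finset.mem_erase, Set.Finite.mem_toFinset] at hm
          have : coloredKostka Q P.toWSent = 0 := by
            by_contra h0
            exact hm ⟨Ne.symm hPQ, h0⟩
          simp [this]
  obtain ⟨f, hf⟩ := ex _ P rfl
  refine ⟨f, hf, fun g hg => ?_⟩
  have hd : ∀ Q : PSent A, pairing A (g - f) (coloredDualSchur Q) = 0 := fun Q => by
    rw [map_sub, LinearMap.sub_apply, hg Q, hf Q, sub_self]
  rw [← sub_eq_zero]
  by_contra hne
  set c := (completeBasis A).repr (g - f) with hc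
  have hc0 : c ≠ 0 := fun h => hne ((completeBasis A).repr.map_eq_zero_iff.1 h)
  obtain ⟨R, hR, hmax⟩ := Finset.exists_max_image c.support PSent.rank
    (Finsupp.support_nonempty_iff.2 hc0)
  have h1 : g - f = ∑ Q ∈ c.support, c Q • completeA Q := by
    conv_lhs => rw [← (completeBasis A).linearCombination_repr (g - f)]
    rw [Finsupp.linearCombination_apply, Finsupp.sum]
    simp only [completeBasis_apply, hc]
  have h2 := hd R
  rw [h1, map_sum, LinearMap.sum_apply, Finset.sum_eq_single R] at h2
  · rw [map_smul, LinearMap.smul_apply, pairing_completeA_coloredDualSchur, coloredKostka_self,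
      Nat.cast_one, smul_eq_mul, mul_one] at h2
    exact Finsupp.mem_support_iff.1 hR h2
  · intro Q hQ hQR
    rw [map_smul, LinearMap.smul_apply, pairing_completeA_coloredDualSchur]
    have : coloredKostka R Q.toWSent = 0 := by
      by_contra h0
      rcases coloredKostka_triangular h0 with h | h
      · exact absurd (hmax Q hQ) (not_le.2 h)
      · exact hQR h.symm
    simp [this]
  · intro h
    exact absurd hR h

/-- The colored Schur function `s_P`: the unique element of `PSym_A` with
`⟨s_P, s*_Q⟩ = δ_{P,Q}` for all p-sentences `Q`; see `pairing_coloredSchur`. -/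
def coloredSchur [Finite A] (P : PSent A) : PSymA A := (existsUnique_coloredSchur P).choose

open scoped Classical in
theorem pairing_coloredSchur [Finite A] (P Q : PSent A) :
    pairing A (coloredSchur P) (coloredDualSchur Q) = if P = Q then 1 else 0 :=
  (existsUnique_coloredSchur P).choose_spec.1 Q

end

end ColoredSym

/-! With a single color a word is its length, a p-sentence is a partition, and the type of a tableau
is its content. Hence the colored Kostka numbers are the ordinary Kostka numbers `K_{λ,α}`
(`coloredKostka_eq_kostka`), and two classical facts remain: the expansion `h_μ = ∑_λ K_{λ,μ} s_λ`
and the symmetry of `K_{λ,α}` in `α`.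

The expansion follows from Pieri's rule: multiplying by `h_n` adds a horizontal strip of size `n`,
and a tableau is a chain of diagrams growing by horizontal strips. Pieri's rule is proved in `m`
variables by induction on `m` (`truncSchur_mul_truncComplete`). Splitting off the last variable
removes a horizontal strip, so the inductive step asks that adding and removing strips commute up to
a geometric series. That is the bijection `exists_localRule`, which reflects each row in the
interval left free by its neighbours.

For `s_Q`, duality gives `h_P = ∑_R K_{R,P} s_R` in `PSym_A`. Its image under `υ` and the classical
expansion have the same unitriangular coefficients, so `υ(s_P) = s_{wℓ(P)}` by induction on
`PSent.rank`. For `s*_P`, the coefficient of `x^α` in the image is the Kostka number of the sorted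
`α`. It equals that of `α` because the Schur function is symmetric, and this symmetry comes from the
first half: the Schur function is a value of `υ`, which lies in `Sym`. -/

namespace YoungDiagram

open Finset

/-! ### Young diagrams as sequences of row lengths -/

theorem rowLen_injective : Function.Injective rowLen := by
  intro μ ν h
  refine YoungDiagram.ext (Finset.ext fun ⟨i, j⟩ => ?_)
  rw [mem_cells, mem_cells, mem_iff_lt_rowLen, mem_iff_lt_rowLen, h]

theorem card_eq_sum_rowLen (μ : YoungDiagram) {N : ℕ} (h : μ.rowLen N = 0) :
    μ.card = ∑ i ∈ range N, μ.rowLen i := by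
  rw [YoungDiagram.card, Finset.card_eq_sum_card_fiberwise (f := Prod.fst) (t := range N)]
  · exact Finset.sum_congr rfl fun i _ => (rowLen_eq_card μ).symm
  · rintro ⟨i, j⟩ hc
    rw [mem_coe, mem_cells, mem_iff_lt_rowLen] at hc
    rw [mem_coe, mem_range]
    by_contra hi
    have := μ.rowLen_anti N i (not_lt.1 hi)
    omega

theorem exists_rowLen_eq_zero (μ : YoungDiagram) : ∃ N, ∀ i, N ≤ i → μ.rowLen i = 0 := by
  refine ⟨μ.colLen 0, fun i hi => ?_⟩
  by_contra h
  have : (i, 0) ∈ μ := mem_iff_lt_rowLen.2 (Nat.pos_of_ne_zero h)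
  rw [mem_iff_lt_colLen] at this
  omega

theorem exists_rowLen_eq {f : ℕ → ℕ} (hf : Antitone f) {N : ℕ} (hN : f N = 0) :
    ∃ μ : YoungDiagram, μ.rowLen = f := by
  let μ : YoungDiagram :=
    { cells := (range N ×ˢ range (f 0)).filter fun c => c.2 < f c.1
      isLowerSet := by
        rintro ⟨i, j⟩ ⟨i', j'⟩ ⟨hi, hj⟩ h
        have := hf hi
        have := hf (Nat.zero_le i')
        simp only [coe_filter, mem_product, mem_range, Set.mem_ofPred_eq] at h ⊢
        have : f i ≤ f i' := hf hi
        dsimp only at hi hj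
        omega }
  refine ⟨μ, funext fun i => ?_⟩
  have key : ∀ j, j < μ.rowLen i ↔ j < f i := fun j => by
    rw [← mem_iff_lt_rowLen, ← mem_cells]
    simp only [μ, mem_filter, mem_product, mem_range]
    refine ⟨And.right, fun h => ⟨⟨?_, h.trans_le (hf (Nat.zero_le i))⟩, h⟩⟩
    by_contra hi
    have := hf (not_lt.1 hi)
    omega
  exact eq_of_forall_lt_iff key

theorem finite_card_eq (n : ℕ) : {μ : YoungDiagram | μ.card = n}.Finite := by
  refine Set.Finite.of_injOn (f := cells) (t := ((range n ×ˢ range n).powerset : Set _)) ?_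
    (fun _ _ _ _ h => YoungDiagram.ext h) (finite_toSet _)
  rintro μ rfl
  rw [mem_coe, mem_powerset]
  rintro ⟨i, j⟩ h
  rw [mem_cells] at h
  rw [mem_product, mem_range, mem_range]
  constructor
  · refine (mem_iff_lt_colLen.1 h).trans_le ?_
    rw [colLen_eq_card]
    exact card_le_card (filter_subset _ _)
  · refine (mem_iff_lt_rowLen.1 h).trans_le ?_
    rw [rowLen_eq_card]
    exact card_le_card (filter_subset _ _)

/-- The Young diagrams with `n` cells. -/
noncomputable def ofCard (n : ℕ) : Finset YoungDiagram := (finite_card_eq n).toFinset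

@[simp]
theorem mem_ofCard {n : ℕ} {μ : YoungDiagram} : μ ∈ ofCard n ↔ μ.card = n := by
  simp [ofCard]

/-! ### Horizontal strips -/

/-- `κ ≺ μ`: the rows interlace, that is, `κ ⊆ μ` and `μ / κ` is a horizontal strip. -/
def Interlaces (κ μ : YoungDiagram) : Prop :=
  ∀ i, κ.rowLen i ≤ μ.rowLen i ∧ μ.rowLen (i + 1) ≤ κ.rowLen i

theorem Interlaces.le {κ μ : YoungDiagram} (h : κ.Interlaces μ) : κ ≤ μ := by
  rintro ⟨i, j⟩ hc
  exact mem_iff_lt_rowLen.2 ((mem_iff_lt_rowLen.1 hc).trans_le (h i).1)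

theorem Interlaces.card_le {κ μ : YoungDiagram} (h : κ.Interlaces μ) : κ.card ≤ μ.card :=
  card_le_card (cells_subset_iff.2 h.le)

open scoped Classical in
/-- The diagrams obtained from `μ` by removing a horizontal strip. -/
noncomputable def below (μ : YoungDiagram) : Finset YoungDiagram :=
  ((range (μ.card + 1)).biUnion ofCard).filter fun κ => κ.Interlaces μ

@[simp]
theorem mem_below {κ μ : YoungDiagram} : κ ∈ below μ ↔ κ.Interlaces μ := by
  simp only [below, mem_filter, mem_biUnion, mem_range, mem_ofCard, and_iff_right_iff_imp]
  exact fun h => ⟨_, Nat.lt_succ_of_le h.card_le, rfl⟩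

open scoped Classical in
/-- The diagrams obtained from `μ` by adding a horizontal strip of size `n`. -/
noncomputable def above (μ : YoungDiagram) (n : ℕ) : Finset YoungDiagram :=
  (ofCard (μ.card + n)).filter fun ν => μ.Interlaces ν

@[simp]
theorem mem_above {μ ν : YoungDiagram} {n : ℕ} :
    ν ∈ above μ n ↔ μ.Interlaces ν ∧ ν.card = μ.card + n := by
  simp only [above, mem_filter, mem_ofCard, and_comm]

theorem bot_interlaces_bot : (⊥ : YoungDiagram).Interlaces ⊥ := by
  have h : ∀ i, (⊥ : YoungDiagram).rowLen i = 0 := fun i => by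
    by_contra hi
    exact notMem_bot (i, 0) (mem_iff_lt_rowLen.2 (Nat.pos_of_ne_zero hi))
  intro i
  simp [h]

/-! ### The local rule: commuting the addition and removal of strips -/

/-- The local rule: the diagram `τ` below `μ` and `κ` that corresponds to a diagram `ν` above
both of them. -/
theorem exists_localRule_down {μ κ ν : YoungDiagram} (h1 : μ.Interlaces ν) (h2 : κ.Interlaces ν) :
    ∃ τ : YoungDiagram, ∀ i, τ.rowLen i + ν.rowLen (i + 1) =
      max (μ.rowLen (i + 1)) (κ.rowLen (i + 1)) + min (μ.rowLen i) (κ.rowLen i) := by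
  obtain ⟨N, hN⟩ := μ.exists_rowLen_eq_zero
  -- Interlacing places `ν_{i+1}` in the interval from `max(μ_{i+1}, κ_{i+1})` to `min(μ_i, κ_i)`,
  -- and `τ_i` is its reflection there. As `min(μ_{i+1}, κ_{i+1}) ≤ max(μ_{i+1}, κ_{i+1})`,
  -- consecutive intervals are ordered, so `τ` is antitone.
  obtain ⟨f, hf⟩ : ∃ f : ℕ → ℕ, ∀ i, f i + ν.rowLen (i + 1) =
      max (μ.rowLen (i + 1)) (κ.rowLen (i + 1)) + min (μ.rowLen i) (κ.rowLen i) := by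
    refine ⟨fun i => max (μ.rowLen (i + 1)) (κ.rowLen (i + 1)) + min (μ.rowLen i) (κ.rowLen i) -
      ν.rowLen (i + 1), fun i => Nat.sub_add_cancel ?_⟩
    have := h1 i
    have := h2 i
    omega
  obtain ⟨τ, rfl⟩ := exists_rowLen_eq (f := f) (N := N) (antitone_nat_of_succ_le fun i => by
      have := h1 i
      have := h2 i
      have := h1 (i + 1)
      have := h2 (i + 1)
      have := h1 (i + 1 + 1)
      have := h2 (i + 1 + 1)
      have := hf i
      have := hf (i + 1)
      omega) (by
      -- `τ_N = 0`, since `μ_N = μ_{N+1} = 0` and `κ_{N+1} ≤ ν_{N+1} ≤ μ_N`.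
      have := hf N
      have := h2 N
      have := hN N le_rfl
      have := hN (N + 1) (Nat.le_succ N)
      have := h2 (N + 1)
      omega)
  exact ⟨τ, hf⟩

/-- The local rule: the diagram `ν` above `μ` and `κ` that corresponds to a diagram `τ` below
both of them and a natural number. -/
theorem exists_localRule_up {μ κ τ : YoungDiagram} (h1 : τ.Interlaces μ) (h2 : τ.Interlaces κ)
    (k : ℕ) : ∃ ν : YoungDiagram, ν.rowLen 0 = max (μ.rowLen 0) (κ.rowLen 0) + k ∧
      ∀ i, τ.rowLen i + ν.rowLen (i + 1) =
        max (μ.rowLen (i + 1)) (κ.rowLen (i + 1)) + min (μ.rowLen i) (κ.rowLen i) := by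
  obtain ⟨N, hN⟩ := μ.exists_rowLen_eq_zero
  -- The same reflection, read from `τ_i` to `ν_{i+1}`. Row `0` of `ν` is only bounded below, and
  -- its excess over that bound is the free parameter `k`.
  obtain ⟨f, hf0, hf⟩ : ∃ f : ℕ → ℕ, f 0 = max (μ.rowLen 0) (κ.rowLen 0) + k ∧
      ∀ i, τ.rowLen i + f (i + 1) =
        max (μ.rowLen (i + 1)) (κ.rowLen (i + 1)) + min (μ.rowLen i) (κ.rowLen i) := by
    refine ⟨fun i => i.casesOn (max (μ.rowLen 0) (κ.rowLen 0) + k)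
      fun i => max (μ.rowLen (i + 1)) (κ.rowLen (i + 1)) +
        min (μ.rowLen i) (κ.rowLen i) - τ.rowLen i, rfl, fun i => Nat.add_sub_cancel' ?_⟩
    have := h1 i
    have := h2 i
    omega
  obtain ⟨ν, rfl⟩ := exists_rowLen_eq (f := f) (N := N + 1 + 1)
    (antitone_nat_of_succ_le fun i => by
      have := h1 i
      have := h2 i
      have := hf i
      cases i with
      | zero => omega
      | succ i =>
        have := h1 i
        have := h2 i
        have := hf i
        omega) (by
      have := h1 N
      have := h1 (N + 1)
      have := h2 (N + 1)
      have := h2 N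
      have := hf (N + 1)
      have := hN N le_rfl
      have := hN (N + 1) (Nat.le_succ N)
      have := hN (N + 1 + 1) (by omega)
      omega)
  exact ⟨ν, hf0, hf⟩

/-- Sum the relation over all rows: the maximum and the minimum belonging to the same row add up to
`μ_i + κ_i`. -/
theorem card_localRule {μ κ ν τ : YoungDiagram} {k : ℕ}
    (h0 : ν.rowLen 0 = max (μ.rowLen 0) (κ.rowLen 0) + k)
    (h : ∀ i, τ.rowLen i + ν.rowLen (i + 1) =
      max (μ.rowLen (i + 1)) (κ.rowLen (i + 1)) + min (μ.rowLen i) (κ.rowLen i)) :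
    τ.card + ν.card = μ.card + κ.card + k := by
  obtain ⟨N, hN⟩ := μ.exists_rowLen_eq_zero
  obtain ⟨M, hM⟩ := κ.exists_rowLen_eq_zero
  have hμ := hN (max N M) (le_max_left _ _)
  have hκ := hM (max N M) (le_max_right _ _)
  have hμ' := hN (max N M + 1) ((le_max_left _ _).trans (Nat.le_succ _))
  have hκ' := hM (max N M + 1) ((le_max_right _ _).trans (Nat.le_succ _))
  generalize max N M = n at hμ hκ hμ' hκ'
  have hn := h n
  rw [card_eq_sum_rowLen τ (N := n) (by omega), card_eq_sum_rowLen ν (N := n + 1) (by omega),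
    card_eq_sum_rowLen μ hμ, card_eq_sum_rowLen κ hκ, sum_range_succ', h0]
  -- After `l` rows the maximum of row `l` has appeared but its minimum has not, which accounts for
  -- the last term.
  have key : ∀ l, ∑ i ∈ range l, τ.rowLen i + ∑ i ∈ range l, ν.rowLen (i + 1) +
      max (μ.rowLen 0) (κ.rowLen 0) =
      ∑ i ∈ range l, μ.rowLen i + ∑ i ∈ range l, κ.rowLen i + max (μ.rowLen l) (κ.rowLen l) := by
    intro l
    induction l with
    | zero => simp
    | succ l ih =>
      simp only [sum_range_succ]
      have := h l
      omega
  have := key n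
  omega

/-- A reflection stays in its interval, and `max(μ_{i+1}, κ_{i+1}) ≤ τ_i ≤ min(μ_i, κ_i)` for all
`i` says exactly that `τ` interlaces below both diagrams. -/
theorem interlaces_of_localRule_down {μ κ ν τ : YoungDiagram} (h1 : μ.Interlaces ν)
    (h2 : κ.Interlaces ν) (h : ∀ i, τ.rowLen i + ν.rowLen (i + 1) =
      max (μ.rowLen (i + 1)) (κ.rowLen (i + 1)) + min (μ.rowLen i) (κ.rowLen i)) :
    τ.Interlaces μ ∧ τ.Interlaces κ := by
  constructor <;>
  · intro i
    have := h1 i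
    have := h2 i
    have := h1 (i + 1)
    have := h2 (i + 1)
    have := h i
    omega

theorem interlaces_of_localRule_up {μ κ ν τ : YoungDiagram} (h1 : τ.Interlaces μ)
    (h2 : τ.Interlaces κ) (h0 : max (μ.rowLen 0) (κ.rowLen 0) ≤ ν.rowLen 0)
    (h : ∀ i, τ.rowLen i + ν.rowLen (i + 1) =
      max (μ.rowLen (i + 1)) (κ.rowLen (i + 1)) + min (μ.rowLen i) (κ.rowLen i)) :
    μ.Interlaces ν ∧ κ.Interlaces ν := by
  constructor <;>
  · intro i
    have := h1 i
    have := h2 i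
    have := h i
    cases i with
    | zero => omega
    | succ i =>
      have := h1 i
      have := h2 i
      have := h i
      omega

/-- The commutation relation of adding and removing horizontal strips, as an equivalence. -/
theorem exists_localRule (μ κ : YoungDiagram) :
    ∃ e : {ν : YoungDiagram // μ.Interlaces ν ∧ κ.Interlaces ν} ≃
      {τ : YoungDiagram // τ.Interlaces μ ∧ τ.Interlaces κ} × ℕ,
      ∀ ν, (e ν).1.1.card + ν.1.card = μ.card + κ.card + (e ν).2 := by
  choose f hf using fun ν : {ν : YoungDiagram // μ.Interlaces ν ∧ κ.Interlaces ν} =>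
    exists_localRule_down ν.2.1 ν.2.2
  choose g hg0 hg using
    fun p : {τ : YoungDiagram // τ.Interlaces μ ∧ τ.Interlaces κ} × ℕ =>
      exists_localRule_up p.1.2.1 p.1.2.2 p.2
  -- The symmetric relation determines `τ` from `ν`, and every row of `ν` except row `0` from `τ`;
  -- row `0` is recovered from `k`. So the two constructions are mutually inverse.
  refine ⟨⟨fun ν => ⟨⟨f ν, interlaces_of_localRule_down ν.2.1 ν.2.2 (hf ν)⟩,
    ν.1.rowLen 0 - max (μ.rowLen 0) (κ.rowLen 0)⟩, fun p => ⟨g p,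
    interlaces_of_localRule_up p.1.2.1 p.1.2.2 ((Nat.le_add_right _ _).trans_eq (hg0 p).symm)
      (hg p)⟩, fun ν => ?_, fun p => ?_⟩, fun ν => card_localRule ?_ (hf ν)⟩
  · refine Subtype.ext (rowLen_injective (funext fun i => ?_))
    cases i with
    | zero =>
      have := ν.2.1 0
      have := ν.2.2 0
      refine (hg0 _).trans ?_
      dsimp only
      omega
    | succ i =>
      have := hf ν i
      have := hg (⟨⟨f ν, interlaces_of_localRule_down ν.2.1 ν.2.2 (hf ν)⟩,
        ν.1.rowLen 0 - max (μ.rowLen 0) (κ.rowLen 0)⟩) i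
      dsimp only at this ⊢
      omega
  · refine Prod.ext (Subtype.ext (rowLen_injective (funext fun i => ?_))) ?_
    · have := hg p i
      have := hf ⟨g p, interlaces_of_localRule_up p.1.2.1 p.1.2.2
        ((Nat.le_add_right _ _).trans_eq (hg0 p).symm) (hg p)⟩ i
      dsimp only at this ⊢
      omega
    · dsimp only
      rw [hg0]
      omega
  · have := ν.2.1 0
    have := ν.2.2 0
    dsimp only [Equiv.coe_fn_mk]
    omega

end YoungDiagram

namespace ColoredSym

open Finset YoungDiagram

/-! ### Contents and Kostka numbers -/

theorem content_apply {lam : YoungDiagram} (T : SemistandardYoungTableau lam) (i : ℕ) :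
    content T i = #{c ∈ lam.cells | T c.1 c.2 = i} := by
  rw [content, Finsupp.finsetSum_apply, card_filter]
  exact sum_congr rfl fun c _ => Finsupp.single_apply

theorem content_ne_zero_of_mem {lam : YoungDiagram} (T : SemistandardYoungTableau lam) {i j : ℕ}
    (h : (i, j) ∈ lam) : content T (T i j) ≠ 0 := by
  rw [content_apply, Finset.card_ne_zero]
  exact ⟨(i, j), mem_filter.2 ⟨(mem_cells _).2 h, rfl⟩⟩

/-- Entries in the diagram lie in the support of `α`, so there are finitely many fillings and the
`Nat.card` in `kostka` is a genuine count. -/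
instance finite_content_eq (lam : YoungDiagram) (α : ℕ →₀ ℕ) :
    Finite {T : SemistandardYoungTableau lam // content T = α} := by
  refine Finite.of_injective (β := lam.cells → α.support) (fun T c => ⟨T.1 c.1.1 c.1.2, ?_⟩) ?_
  · rw [Finsupp.mem_support_iff]
    exact fun h => content_ne_zero_of_mem T.1 c.2 ((DFunLike.congr_fun T.2 _).trans h)
  · intro S T h
    refine Subtype.ext (SemistandardYoungTableau.ext fun i j => ?_)
    by_cases hc : (i, j) ∈ lam
    · exact congrArg Subtype.val (congrFun h ⟨(i, j), hc⟩)
    · rw [S.1.zeros hc, T.1.zeros hc]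

/-- The number of semistandard Young tableaux of shape `λ` and content `α`. -/
noncomputable def kostka (lam : YoungDiagram) (α : ℕ →₀ ℕ) : ℕ :=
  Nat.card {T : SemistandardYoungTableau lam // content T = α}

theorem coeff_schur (lam : YoungDiagram) (α : ℕ →₀ ℕ) :
    MvPowerSeries.coeff α (schur lam) = kostka lam α := rfl

theorem kostka_zero (lam : YoungDiagram) [Decidable (lam = ⊥)] :
    kostka lam 0 = if lam = ⊥ then 1 else 0 := by
  split_ifs with h
  · subst h
    refine Nat.card_eq_one_iff_unique.2 ⟨⟨fun S T => ?_⟩, ⟨⟨default, rfl⟩⟩⟩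
    exact Subtype.ext (SemistandardYoungTableau.ext fun i j => by
      rw [S.1.zeros (notMem_bot _), T.1.zeros (notMem_bot _)])
  · have : IsEmpty {T : SemistandardYoungTableau lam // content T = 0} := by
      refine ⟨fun T => h (YoungDiagram.ext (eq_empty_of_forall_notMem fun c hc => ?_))⟩
      exact content_ne_zero_of_mem T.1 ((mem_cells _).1 hc) (by rw [T.2]; rfl)
    exact Nat.card_of_isEmpty

/-! ### Branching: removing the largest entries of a tableau -/

/-- The diagram of the entries of a tableau that are smaller than `m`. -/
def ltDiagram {lam : YoungDiagram} (T : SemistandardYoungTableau lam) (m : ℕ) : YoungDiagram where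
  cells := {c ∈ lam.cells | T c.1 c.2 < m}
  isLowerSet := by
    rintro ⟨i, j⟩ ⟨i', j'⟩ ⟨hi, hj⟩ h
    rw [mem_coe, mem_filter, mem_cells] at h ⊢
    have h1 : (i', j) ∈ lam := lam.up_left_mem hi le_rfl h.1
    exact ⟨lam.up_left_mem le_rfl hj h1,
      ((T.row_weak_of_le hj h1).trans (T.col_weak hi h.1)).trans_lt h.2⟩

theorem mem_ltDiagram {lam : YoungDiagram} {T : SemistandardYoungTableau lam} {m i j : ℕ} :
    (i, j) ∈ ltDiagram T m ↔ (i, j) ∈ lam ∧ T i j < m := by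
  rw [← mem_cells, ltDiagram, mem_filter, mem_cells]

theorem entry_le_of_content_eq {lam : YoungDiagram} {T : SemistandardYoungTableau lam}
    {α : ℕ →₀ ℕ} (hT : content T = α) {m : ℕ} (hα : ∀ i, m < i → α i = 0) {i j : ℕ}
    (h : (i, j) ∈ lam) : T i j ≤ m := by
  by_contra hm
  exact content_ne_zero_of_mem T h (hT ▸ hα _ (not_le.1 hm))

/-- Columns increase strictly and no entry exceeds `m`, so the cell above any cell holds an entry
smaller than `m`. -/
theorem ltDiagram_interlaces {lam : YoungDiagram} {T : SemistandardYoungTableau lam} {m : ℕ}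
    (h : ∀ i j, (i, j) ∈ lam → T i j ≤ m) : (ltDiagram T m).Interlaces lam := by
  refine fun i => ⟨le_of_forall_lt fun j hj => ?_, le_of_forall_lt fun j hj => ?_⟩
  · exact mem_iff_lt_rowLen.1 (mem_ltDiagram.1 (mem_iff_lt_rowLen.2 hj)).1
  · have hj' := mem_iff_lt_rowLen.2 hj
    exact mem_iff_lt_rowLen.1 (mem_ltDiagram.2 ⟨lam.up_left_mem (Nat.le_succ i) le_rfl hj',
      (T.col_strict (Nat.lt_succ_self i) hj').trans_le (h _ _ hj')⟩)

theorem card_ltDiagram {lam : YoungDiagram} {T : SemistandardYoungTableau lam} {m : ℕ}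
    (h : ∀ i j, (i, j) ∈ lam → T i j ≤ m) : (ltDiagram T m).card + content T m = lam.card := by
  rw [content_apply, YoungDiagram.card, ltDiagram, YoungDiagram.card,
    ← card_filter_add_card_filter_not (s := lam.cells) fun c => T c.1 c.2 < m]
  congr 2
  refine filter_congr fun c hc => ?_
  have := h c.1 c.2 ((mem_cells _).1 hc)
  omega

/-- The restriction of a tableau to a smaller diagram. -/
def restrictTableau {kap lam : YoungDiagram} (T : SemistandardYoungTableau lam) (h : kap ≤ lam) :
    SemistandardYoungTableau kap where
  entry i j := if (i, j) ∈ kap then T i j else 0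
  row_weak' hj hc := by
    rw [if_pos hc, if_pos (kap.up_left_mem le_rfl hj.le hc)]
    exact T.row_weak hj (h hc)
  col_strict' hi hc := by
    rw [if_pos hc, if_pos (kap.up_left_mem hi.le le_rfl hc)]
    exact T.col_strict hi (h hc)
  zeros' hc := if_neg hc

theorem restrictTableau_apply {kap lam : YoungDiagram} (T : SemistandardYoungTableau lam)
    (h : kap ≤ lam) (i j : ℕ) :
    restrictTableau T h i j = if (i, j) ∈ kap then T i j else 0 := rfl

/-- The extension of a tableau with entries smaller than `m` by a horizontal strip of entries
`m`. -/
def extendTableau {kap lam : YoungDiagram} (T : SemistandardYoungTableau kap)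
    (h : kap.Interlaces lam) (m : ℕ) (hT : ∀ i j, (i, j) ∈ kap → T i j < m) :
    SemistandardYoungTableau lam where
  entry i j := if (i, j) ∈ kap then T i j else if (i, j) ∈ lam then m else 0
  row_weak' {i j1 j2} hj hc := by
    by_cases h2 : (i, j2) ∈ kap
    · rw [if_pos h2, if_pos (kap.up_left_mem le_rfl hj.le h2)]
      exact T.row_weak hj h2
    · rw [if_neg h2, if_pos hc]
      split_ifs with h1
      exacts [(hT _ _ h1).le, le_rfl, Nat.zero_le _]
  col_strict' {i1 i2 j} hi hc := by
    by_cases h2 : (i2, j) ∈ kap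
    · rw [if_pos h2, if_pos (kap.up_left_mem hi.le le_rfl h2)]
      exact T.col_strict hi h2
    -- Since `λ_{i2} ≤ λ_{i1+1} ≤ κ_{i1}`, every cell above a new cell is an old one.
    · have h1 : (i1, j) ∈ kap := mem_iff_lt_rowLen.2 <|
        ((mem_iff_lt_rowLen.1 hc).trans_le (lam.rowLen_anti (i1 + 1) i2 hi)).trans_le (h i1).2
      rw [if_neg h2, if_pos hc, if_pos h1]
      exact hT _ _ h1
  zeros' {i j} hc := by
    rw [if_neg fun hk => hc (h.le hk), if_neg hc]

theorem extendTableau_apply {kap lam : YoungDiagram} (T : SemistandardYoungTableau kap)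
    (h : kap.Interlaces lam) (m : ℕ) (hT : ∀ i j, (i, j) ∈ kap → T i j < m) (i j : ℕ) :
    extendTableau T h m hT i j =
      if (i, j) ∈ kap then T i j else if (i, j) ∈ lam then m else 0 := rfl

theorem content_restrictTableau {lam : YoungDiagram} {T : SemistandardYoungTableau lam} {m : ℕ}
    {kap : YoungDiagram} (hk : ltDiagram T m = kap) (h : kap ≤ lam)
    (hT : ∀ i j, (i, j) ∈ lam → T i j ≤ m) :
    content (restrictTableau T h) = (content T).erase m := by
  subst hk
  ext i
  rw [Finsupp.erase_apply, content_apply, content_apply]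
  split_ifs with hi
  · rw [card_eq_zero, filter_eq_empty_iff]
    intro c hc
    have hc' := (mem_cells c).1 hc
    rw [restrictTableau_apply, if_pos hc', hi]
    exact (mem_ltDiagram.1 hc').2.ne
  · congr 1
    ext ⟨a, b⟩
    rw [mem_filter, mem_filter, mem_cells, mem_cells, restrictTableau_apply]
    dsimp only
    constructor
    · rintro ⟨h1, h2⟩
      rw [if_pos h1] at h2
      exact ⟨h h1, h2⟩
    · rintro ⟨h1, h2⟩
      have := hT _ _ h1
      have h3 : (a, b) ∈ ltDiagram T m := mem_ltDiagram.2 ⟨h1, by omega⟩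
      exact ⟨h3, by rwa [if_pos h3]⟩

theorem ltDiagram_extendTableau {kap lam : YoungDiagram} (T : SemistandardYoungTableau kap)
    (h : kap.Interlaces lam) {m : ℕ} (hT : ∀ i j, (i, j) ∈ kap → T i j < m) :
    ltDiagram (extendTableau T h m hT) m = kap := by
  refine YoungDiagram.ext (Finset.ext fun ⟨i, j⟩ => ?_)
  rw [mem_cells, mem_cells, mem_ltDiagram, extendTableau_apply]
  constructor
  · rintro ⟨h1, h2⟩
    by_contra h3
    rw [if_neg h3, if_pos h1] at h2
    exact lt_irrefl _ h2
  · intro h1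
    rw [if_pos h1]
    exact ⟨h.le h1, hT _ _ h1⟩

theorem restrictTableau_extendTableau {kap lam : YoungDiagram} (T : SemistandardYoungTableau kap)
    (h : kap.Interlaces lam) {m : ℕ} (hT : ∀ i j, (i, j) ∈ kap → T i j < m) :
    restrictTableau (extendTableau T h m hT) h.le = T := by
  ext i j
  rw [restrictTableau_apply, extendTableau_apply]
  split_ifs with h1
  exacts [rfl, (T.zeros h1).symm]

/-- Multiplicities other than that of `m` are seen by restricting back to `kap`; that of `m` is
forced by counting cells. -/
theorem content_extendTableau {kap lam : YoungDiagram} (T : SemistandardYoungTableau kap)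
    (h : kap.Interlaces lam) {m : ℕ} (hT : ∀ i j, (i, j) ∈ kap → T i j < m) {α : ℕ →₀ ℕ}
    (hα : content T = α.erase m) (hm : kap.card + α m = lam.card) :
    content (extendTableau T h m hT) = α := by
  have hle : ∀ i j, (i, j) ∈ lam → extendTableau T h m hT i j ≤ m := by
    intro i j hc
    rw [extendTableau_apply]
    split_ifs with h1
    exacts [(hT _ _ h1).le, le_rfl]
  have h1 := content_restrictTableau (ltDiagram_extendTableau T h hT) h.le hle
  rw [restrictTableau_extendTableau, hα] at h1
  have h2 := card_ltDiagram hle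
  rw [ltDiagram_extendTableau] at h2
  ext i
  by_cases hi : i = m
  · subst hi
    omega
  · have := DFunLike.congr_fun h1 i
    rw [Finsupp.erase_ne hi, Finsupp.erase_ne hi] at this
    exact this.symm

/-- Restriction to `kap` and extension by a strip of `m`'s are inverse bijections; `hm` says that
the strip has the required `α m` cells. -/
theorem card_ltDiagram_eq {kap lam : YoungDiagram} (h : kap.Interlaces lam) {m : ℕ} {α : ℕ →₀ ℕ}
    (hα : ∀ i, m < i → α i = 0) (hm : kap.card + α m = lam.card) :
    Nat.card {T : {T : SemistandardYoungTableau lam // content T = α} // ltDiagram T.1 m = kap} =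
      kostka kap (α.erase m) := by
  have hlt : ∀ T : {T : SemistandardYoungTableau kap // content T = α.erase m},
      ∀ i j, (i, j) ∈ kap → T.1 i j < m := by
    intro T i j hc
    have h0 := content_ne_zero_of_mem T.1 hc
    rw [T.2] at h0
    by_contra hn
    rcases (not_lt.1 hn).eq_or_lt with h1 | h1
    · rw [← h1, Finsupp.erase_same] at h0
      exact h0 rfl
    · rw [Finsupp.erase_ne h1.ne'] at h0
      exact h0 (hα _ h1)
  refine Nat.card_congr ⟨fun T => ⟨restrictTableau T.1.1 h.le, ?_⟩, fun T =>
    ⟨⟨extendTableau T.1 h m (hlt T), content_extendTableau T.1 h (hlt T) T.2 hm⟩,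
      ltDiagram_extendTableau T.1 h (hlt T)⟩, fun T => ?_, fun T => ?_⟩
  · rw [content_restrictTableau T.2 h.le fun i j hc => entry_le_of_content_eq T.1.2 hα hc, T.1.2]
  · refine Subtype.ext (Subtype.ext (SemistandardYoungTableau.ext fun i j => ?_))
    dsimp only
    rw [extendTableau_apply, restrictTableau_apply]
    split_ifs with h1 h2
    · rfl
    · have := entry_le_of_content_eq T.1.2 hα h2
      rw [← T.2, mem_ltDiagram, not_and] at h1
      have := h1 h2
      omega
    · exact (T.1.1.zeros h2).symm
  · exact Subtype.ext (restrictTableau_extendTableau T.1 h (hlt T))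

/-- The branching rule: classify tableaux by the diagram left after erasing the entries `m`, the
largest that `α` allows. -/
theorem kostka_eq_sum_below (lam : YoungDiagram) {m : ℕ} {α : ℕ →₀ ℕ}
    (hα : ∀ i, m < i → α i = 0) :
    kostka lam α =
      ∑ kap ∈ below lam with kap.card + α m = lam.card, kostka kap (α.erase m) := by
  classical
  have := Fintype.ofFinite {T : SemistandardYoungTableau lam // content T = α}
  rw [kostka, Nat.card_eq_fintype_card, ← card_univ, card_eq_sum_card_fiberwise
    (f := fun T => ltDiagram T.1 m) (t := {kap ∈ below lam | kap.card + α m = lam.card})]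
  · refine sum_congr rfl fun kap hk => ?_
    rw [mem_filter, mem_below] at hk
    rw [← card_ltDiagram_eq hk.1 hα hk.2, ← Nat.card_eq_finsetCard]
    exact Nat.card_congr (Equiv.subtypeEquivRight fun T => by simp)
  · intro T _
    have hle : ∀ i j, (i, j) ∈ lam → T.1 i j ≤ m := fun i j hc => entry_le_of_content_eq T.2 hα hc
    rw [mem_coe, mem_filter, mem_below]
    refine ⟨ltDiagram_interlaces hle, ?_⟩
    have := card_ltDiagram hle
    rwa [T.2] at this

/-! ### Schur and complete functions in finitely many variables -/

open scoped Classical in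
/-- The Schur function `s_λ` in the first `m` variables, defined by branching. -/
noncomputable def truncSchur : ℕ → YoungDiagram → MvPowerSeries ℕ ℚ
  | 0, lam => if lam = ⊥ then 1 else 0
  | m + 1, lam => ∑ kap ∈ below lam, truncSchur m kap * MvPowerSeries.X m ^ (lam.card - kap.card)

/-- The complete homogeneous function `h_n` in the first `m` variables. -/
noncomputable def truncComplete : ℕ → ℕ → MvPowerSeries ℕ ℚ
  | 0, n => if n = 0 then 1 else 0
  | m + 1, n => ∑ p ∈ antidiagonal n, truncComplete m p.1 * MvPowerSeries.X m ^ p.2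

/-- The series `f` does not involve `x_m`, so the exponent of `x_m` in the product comes entirely
from the power. -/
theorem coeff_mul_X_pow_of_coeff_eq_zero {f : MvPowerSeries ℕ ℚ} {m : ℕ}
    (hf : ∀ β : ℕ →₀ ℕ, β m ≠ 0 → MvPowerSeries.coeff β f = 0) (α : ℕ →₀ ℕ) (k : ℕ) :
    MvPowerSeries.coeff α (f * MvPowerSeries.X m ^ k) =
      if α m = k then MvPowerSeries.coeff (α.erase m) f else 0 := by
  classical
  rw [MvPowerSeries.X_pow_eq, MvPowerSeries.coeff_mul_monomial, mul_one]
  have hle : Finsupp.single m k ≤ α ↔ k ≤ α m := by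
    rw [Finsupp.single_le_iff]
  simp only [hle]
  split_ifs with h1 h2 h2
  · refine congrArg (fun β => MvPowerSeries.coeff β f) (Finsupp.ext fun i => ?_)
    by_cases hi : i = m
    · subst hi
      rw [Finsupp.tsub_apply, Finsupp.single_eq_same, Finsupp.erase_same, h2, Nat.sub_self]
    · rw [Finsupp.tsub_apply, Finsupp.single_eq_of_ne hi, Finsupp.erase_ne hi, Nat.sub_zero]
  · refine hf _ ?_
    rw [Finsupp.tsub_apply, Finsupp.single_eq_same]
    omega
  · omega
  · rfl

open scoped Classical in
-- The recursion defining `truncSchur` is the branching rule for Kostka numbers, read off at the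
-- exponent of the last variable.
theorem coeff_truncSchur (m : ℕ) (lam : YoungDiagram) (α : ℕ →₀ ℕ) :
    MvPowerSeries.coeff α (truncSchur m lam) =
      if ∀ i, m ≤ i → α i = 0 then (kostka lam α : ℚ) else 0 := by
  induction m generalizing lam α with
  | zero =>
    have h : (∀ i, 0 ≤ i → α i = 0) ↔ α = 0 :=
      ⟨fun h => Finsupp.ext fun i => h i i.zero_le, fun h i _ => by rw [h]; rfl⟩
    rw [truncSchur]
    simp only [h]
    by_cases hα : α = 0
    · subst hα
      rw [if_pos rfl, kostka_zero]
      split_ifs <;> simp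
    · rw [if_neg hα]
      split_ifs
      · rw [MvPowerSeries.coeff_one, if_neg hα]
      · exact map_zero _
  | succ m ih =>
    rw [truncSchur, map_sum]
    have h1 : ∀ kap ∈ below lam, MvPowerSeries.coeff α
        (truncSchur m kap * MvPowerSeries.X m ^ (lam.card - kap.card)) =
        if ∀ i, m + 1 ≤ i → α i = 0 then
          if kap.card + α m = lam.card then (kostka kap (α.erase m) : ℚ) else 0 else 0 := by
      intro kap hk
      have hk' := (mem_below.1 hk).card_le
      rw [coeff_mul_X_pow_of_coeff_eq_zero fun β hβ => by
        rw [ih, if_neg fun h => hβ (h m le_rfl)], ih]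
      have h2 : (∀ i, m ≤ i → (α.erase m) i = 0) ↔ ∀ i, m + 1 ≤ i → α i = 0 := by
        refine forall_congr' fun i => ?_
        by_cases hi : i = m
        · subst hi
          simp
        · rw [Finsupp.erase_ne hi]
          refine imp_congr_left ?_
          omega
      have h3 : α m = lam.card - kap.card ↔ kap.card + α m = lam.card := by omega
      simp only [h2, h3]
      split_ifs <;> rfl
    rw [sum_congr rfl h1]
    split_ifs with h
    · rw [kostka_eq_sum_below lam (m := m) (fun i hi => h i hi), Nat.cast_sum, sum_filter]
    · exact sum_const_zero

open scoped Classical in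
theorem coeff_truncComplete (m n : ℕ) (α : ℕ →₀ ℕ) :
    MvPowerSeries.coeff α (truncComplete m n) =
      if (∀ i, m ≤ i → α i = 0) ∧ α.degree = n then 1 else 0 := by
  induction m generalizing n α with
  | zero =>
    have h : (∀ i, 0 ≤ i → α i = 0) ↔ α = 0 :=
      ⟨fun h => Finsupp.ext fun i => h i i.zero_le, fun h i _ => by rw [h]; rfl⟩
    rw [truncComplete]
    simp only [h]
    by_cases hα : α = 0
    · subst hα
      by_cases hn : n = 0
      · simp [hn]
      · simp [hn, Ne.symm hn]
    · simp only [hα, false_and, if_false]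
      split_ifs
      · rw [MvPowerSeries.coeff_one, if_neg hα]
      · exact map_zero _
  | succ m ih =>
    rw [truncComplete, map_sum]
    have hdeg : (α.erase m).degree + α m = α.degree := by
      conv_rhs => rw [← Finsupp.erase_add_single m α, map_add, Finsupp.degree_single]
    -- Only one splitting of the degree contributes: the one whose second part is the exponent of
    -- `x_m` in `x^α`.
    have h1 : ∀ p ∈ antidiagonal n, MvPowerSeries.coeff α
        (truncComplete m p.1 * MvPowerSeries.X m ^ p.2) =
        if p = ((α.erase m).degree, α m) then
          if (∀ i, m + 1 ≤ i → α i = 0) then (1 : ℚ) else 0 else 0 := by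
      intro p hp
      rw [coeff_mul_X_pow_of_coeff_eq_zero fun β hβ => by
        rw [ih, if_neg fun h => hβ (h.1 m le_rfl)], ih]
      have h2 : (∀ i, m ≤ i → (α.erase m) i = 0) ↔ ∀ i, m + 1 ≤ i → α i = 0 := by
        refine forall_congr' fun i => ?_
        by_cases hi : i = m
        · subst hi
          simp
        · rw [Finsupp.erase_ne hi]
          refine imp_congr_left ?_
          omega
      simp only [h2, Prod.ext_iff, eq_comm (a := p.1), eq_comm (a := p.2)]
      split_ifs <;> tauto
    rw [sum_congr rfl h1, sum_ite_eq']
    simp only [HasAntidiagonal.mem_antidiagonal, hdeg]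
    split_ifs <;> tauto

/-! ### Pieri's rule and the Schur expansion of products of complete functions -/

theorem bot_mem_above {lam : YoungDiagram} {n : ℕ} : ⊥ ∈ above lam n ↔ lam = ⊥ ∧ n = 0 := by
  rw [mem_above]
  constructor
  · rintro ⟨h1, h2⟩
    refine ⟨le_bot_iff.1 h1.le, ?_⟩
    rw [YoungDiagram.card, cells_bot, card_empty] at h2
    omega
  · rintro ⟨rfl, rfl⟩
    exact ⟨bot_interlaces_bot, rfl⟩

/-- Pieri's rule in finitely many variables. -/
theorem truncSchur_mul_truncComplete (m : ℕ) (lam : YoungDiagram) (n : ℕ) :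
    truncSchur m lam * truncComplete m n = ∑ nu ∈ above lam n, truncSchur m nu := by
  classical
  induction m generalizing lam n with
  | zero =>
    simp only [truncSchur, truncComplete, sum_ite_eq', bot_mem_above, mul_ite, mul_one,
      mul_zero, ite_and]
    split_ifs <;> rfl
  | succ m ih =>
    -- By induction the left side becomes a sum over `τ ≺ lam`, `τ ≺ κ` and a power `k`, the right
    -- side one over `lam ≺ ν`, `κ ≺ ν`. For fixed `κ` the local rule matches `(τ, k)` with `ν`. The
    -- powers of `x_m` agree because `|lam| - |τ| + k = |ν| - |κ|`.
    choose e he using fun kap => exists_localRule lam kap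
    simp only [truncSchur, truncComplete]
    have h1 : ∀ kap ∈ below lam, ∀ p ∈ antidiagonal n,
        truncSchur m kap * MvPowerSeries.X m ^ (lam.card - kap.card) *
          (truncComplete m p.1 * MvPowerSeries.X m ^ p.2) =
        ∑ nu ∈ above kap p.1,
          truncSchur m nu * MvPowerSeries.X m ^ (lam.card - kap.card + p.2) := by
      intro kap _ p _
      rw [← sum_mul, ← ih, pow_add]
      ring
    rw [sum_mul_sum, sum_congr rfl fun kap hk => sum_congr rfl (h1 kap hk)]
    simp only [sum_sigma']
    have hL : ∀ a : (_ : YoungDiagram) × (_ : ℕ × ℕ) × YoungDiagram,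
        a ∈ (below lam).sigma (fun tau => (antidiagonal n).sigma fun p => above tau p.1) ↔
          a.1.Interlaces lam ∧ a.2.1.1 + a.2.1.2 = n ∧ a.1.Interlaces a.2.2 ∧
            a.2.2.card = a.1.card + a.2.1.1 := fun a => by
      rw [mem_sigma, mem_sigma, mem_below, HasAntidiagonal.mem_antidiagonal, mem_above]
    have hR : ∀ a : (_ : YoungDiagram) × YoungDiagram, a ∈ (above lam n).sigma below ↔
        (lam.Interlaces a.1 ∧ a.1.card = lam.card + n) ∧ a.2.Interlaces a.1 := fun a => by
      rw [mem_sigma, mem_above, mem_below]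
    have he' : ∀ kap x, x.1.1.card + ((e kap).symm x).1.card = lam.card + kap.card + x.2 :=
      fun kap x => by simpa using he kap ((e kap).symm x)
    refine sum_bij'
      (i := fun a ha => ⟨((e a.2.2).symm
        (⟨a.1, ((hL a).1 ha).1, ((hL a).1 ha).2.2.1⟩, a.2.1.2)).1, a.2.2⟩)
      (j := fun a ha => ⟨(e a.2 ⟨a.1, ((hR a).1 ha).1.1, ((hR a).1 ha).2⟩).1.1,
        (n - (e a.2 ⟨a.1, ((hR a).1 ha).1.1, ((hR a).1 ha).2⟩).2,
          (e a.2 ⟨a.1, ((hR a).1 ha).1.1, ((hR a).1 ha).2⟩).2), a.2⟩) ?_ ?_ ?_ ?_ ?_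
    · rintro ⟨tau, ⟨b, k⟩, kap⟩ ha
      have ha' := (hL _).1 ha
      rw [hR]
      dsimp only at ha' ⊢
      have h2 := he' kap (⟨tau, ha'.1, ha'.2.2.1⟩, k)
      dsimp only at h2
      refine ⟨⟨Subtype.prop (p := fun nu => lam.Interlaces nu ∧ kap.Interlaces nu) _ |>.1, ?_⟩,
        Subtype.prop (p := fun nu => lam.Interlaces nu ∧ kap.Interlaces nu) _ |>.2⟩
      omega
    · rintro ⟨nu, kap⟩ ha
      have ha' := (hR _).1 ha
      rw [hL]
      dsimp only at ha' ⊢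
      have h2 := he kap ⟨nu, ha'.1.1, ha'.2⟩
      generalize (e kap) ⟨nu, ha'.1.1, ha'.2⟩ = x at h2 ⊢
      have h3 := x.1.2.2.card_le
      have h4 := ha'.1.2
      dsimp only at h2
      refine ⟨x.1.2.1, ?_, x.1.2.2, ?_⟩ <;> omega
    · rintro ⟨tau, ⟨b, k⟩, kap⟩ ha
      have ha' := (hL _).1 ha
      dsimp only at ha' ⊢
      simp only [Subtype.coe_eta, Equiv.apply_symm_apply]
      rw [← ha'.2.1, Nat.add_sub_cancel]
    · rintro ⟨nu, kap⟩ ha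
      simp only [Subtype.coe_eta, Prod.mk.eta, Equiv.symm_apply_apply]
    · rintro ⟨tau, ⟨b, k⟩, kap⟩ ha
      have ha' := (hL _).1 ha
      dsimp only at ha' ⊢
      have h2 := he' kap (⟨tau, ha'.1, ha'.2.2.1⟩, k)
      have h3 := ha'.1.card_le
      dsimp only at h2
      congr 2
      omega

theorem truncSchur_bot (m : ℕ) : truncSchur m ⊥ = 1 := by
  induction m with
  | zero => rw [truncSchur, if_pos rfl]
  | succ m ih =>
    have h : below ⊥ = {⊥} := by
      ext kap
      rw [mem_below, mem_singleton]
      exact ⟨fun h => le_bot_iff.1 h.le, fun h => h ▸ bot_interlaces_bot⟩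
    rw [truncSchur, h, sum_singleton, ih, Nat.sub_self, pow_zero, mul_one]

/-- By Pieri's rule the last factor `h_n` adds a horizontal strip of size `n`; filled with a new
largest entry, this strip extends the tableaux counted so far. -/
theorem prod_truncComplete (m : ℕ) (l : List ℕ) :
    (l.map (truncComplete m)).prod =
      ∑ lam ∈ ofCard l.sum, (kostka lam l.toFinsupp : ℚ) • truncSchur m lam := by
  classical
  -- Parts are appended at the end so that the new one, at index `l.length`, counts the largest
  -- entry.
  induction l using List.reverseRecOn with
  | nil =>
    have h : ofCard 0 = {⊥} := by
      ext lam
      rw [mem_ofCard, mem_singleton, YoungDiagram.card, card_eq_zero, ← cells_bot]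
      exact ⟨YoungDiagram.ext, congrArg _⟩
    rw [List.map_nil, List.prod_nil, List.sum_nil, h, sum_singleton, truncSchur_bot,
      List.toFinsupp_nil, kostka_zero, if_pos rfl, Nat.cast_one, one_smul]
  | append_singleton l n ih =>
    have hs : (l ++ [n]).toFinsupp = l.toFinsupp + Finsupp.single l.length n :=
      List.toFinsupp_concat_eq_toFinsupp_add_single _ _
    have h0 : ∀ i, l.length ≤ i → l.toFinsupp i = 0 := fun i hi => List.toFinsupp_apply_le _ _ hi
    have h1 : (l ++ [n]).toFinsupp l.length = n := by
      rw [hs, Finsupp.add_apply, h0 _ le_rfl, Finsupp.single_eq_same, zero_add]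
    have h2 : (l ++ [n]).toFinsupp.erase l.length = l.toFinsupp := by
      ext i
      by_cases hi : i = l.length
      · rw [hi, Finsupp.erase_same, h0 _ le_rfl]
      · rw [Finsupp.erase_ne hi, hs, Finsupp.add_apply, Finsupp.single_eq_of_ne hi, add_zero]
    have h3 : ∀ i, l.length < i → (l ++ [n]).toFinsupp i = 0 := fun i hi => by
      rw [hs, Finsupp.add_apply, h0 _ hi.le, Finsupp.single_eq_of_ne hi.ne', add_zero]
    rw [List.map_append, List.prod_append, ih, List.map_singleton, List.prod_singleton, sum_mul,
      List.sum_append, List.sum_singleton]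
    simp only [smul_mul_assoc, truncSchur_mul_truncComplete, smul_sum]
    simp only [kostka_eq_sum_below _ h3, h1, h2, Nat.cast_sum, sum_smul]
    -- Both sides run over pairs `kap ≺ lam` with `|kap| = l.sum` and `|lam| = |kap| + n`.
    refine sum_comm' fun kap lam => ?_
    rw [mem_ofCard, mem_above, mem_filter, mem_below, mem_ofCard]
    constructor
    · rintro ⟨h4, h5, h6⟩
      exact ⟨⟨h5, h6.symm⟩, by rw [h6, h4]⟩
    · rintro ⟨⟨h5, h6⟩, h4⟩
      exact ⟨by omega, h5, h6.symm⟩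

/-- A monomial in the first `m` variables factors only into such monomials, so coefficients
elsewhere do not matter. -/
theorem coeff_prod_congr {m : ℕ} (l : List ℕ) {f g : ℕ → MvPowerSeries ℕ ℚ}
    (h : ∀ (n : ℕ) (α : ℕ →₀ ℕ), (∀ i, m ≤ i → α i = 0) →
      MvPowerSeries.coeff α (f n) = MvPowerSeries.coeff α (g n))
    {α : ℕ →₀ ℕ} (hα : ∀ i, m ≤ i → α i = 0) :
    MvPowerSeries.coeff α (l.map f).prod = MvPowerSeries.coeff α (l.map g).prod := by
  classical
  induction l generalizing α with
  | nil => rfl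
  | cons n l ih =>
    simp only [List.map_cons, List.prod_cons, MvPowerSeries.coeff_mul]
    refine sum_congr rfl fun p hp => ?_
    rw [HasAntidiagonal.mem_antidiagonal] at hp
    have hp' : ∀ i, m ≤ i → p.1 i = 0 ∧ p.2 i = 0 := fun i hi => by
      have := hα i hi
      rw [← hp, Finsupp.add_apply] at this
      omega
    rw [h _ _ fun i hi => (hp' i hi).1, ih fun i hi => (hp' i hi).2]

/-- The Schur expansion of the products of complete homogeneous symmetric functions. -/
theorem prod_completeSym (l : List ℕ) :
    ((l.map completeSym).prod : Sym) =
      ∑ lam ∈ ofCard l.sum, (kostka lam l.toFinsupp : ℚ) • schur lam := by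
  classical
  ext α
  -- The monomial `x^α` involves finitely many variables, so its coefficient is seen in the
  -- truncation to `m` of them.
  obtain ⟨m, hm⟩ : ∃ m, ∀ i, m ≤ i → α i = 0 := by
    refine ⟨α.support.sup id + 1, fun i hi => ?_⟩
    by_contra h
    have := le_sup (f := id) (Finsupp.mem_support_iff.2 h)
    dsimp only [id] at this
    omega
  rw [← Subalgebra.coe_val, map_list_prod, List.map_map, coeff_prod_congr (m := m)
    (g := truncComplete m) l (fun n β hβ => ?_) hm, prod_truncComplete, map_sum, map_sum]
  · refine sum_congr rfl fun lam _ => ?_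
    rw [MvPowerSeries.coeff_smul, MvPowerSeries.coeff_smul, coeff_truncSchur, if_pos hm,
      coeff_schur]
  · rw [coeff_truncComplete]
    rw [Function.comp_apply]
    change (if β.degree = n then (1 : ℚ) else 0) = _
    simp +contextual [hβ]

/-! ### Words, p-sentences and tableaux in one color -/

variable {A : Type*}

theorem list_eq_of_length_eq [Subsingleton A] {l l' : List A} (h : l.length = l'.length) :
    l = l' :=
  List.ext_getElem h fun _ _ _ => Subsingleton.elim _ _

/-- The lengths of the words of a weak sentence. -/
noncomputable def WSent.lengths (K : WSent A) : ℕ →₀ ℕ := K.mapRange FreeAddMonoid.length rfl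

theorem WSent.lengths_apply (K : WSent A) (i : ℕ) : K.lengths i = (K i).length := rfl

/-- The weak sentence with given word lengths that uses only one color. -/
noncomputable def WSent.ofLengths (a : A) (α : ℕ →₀ ℕ) : WSent A :=
  α.mapRange (fun n => FreeAddMonoid.ofList (List.replicate n a)) rfl

theorem WSent.lengths_ofLengths (a : A) (α : ℕ →₀ ℕ) : (WSent.ofLengths a α).lengths = α := by
  ext i
  exact List.length_replicate

theorem WSent.map_length_words (K : WSent A) :
    K.words.map Word.length = K.lengths.support.val.map K.lengths := by
  have h : K.lengths.support = K.support := by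
    ext i
    rw [Finsupp.mem_support_iff, Finsupp.mem_support_iff, WSent.lengths_apply, Ne, Ne,
      FreeAddMonoid.length_eq_zero]
  rw [h, WSent.words, Multiset.map_map]
  exact Multiset.attach_map_val' _ K.lengths

theorem WSent.lengths_equivMapDomain (K : WSent A) (σ : Equiv.Perm ℕ) :
    WSent.lengths (K.equivMapDomain σ) = K.lengths.equivMapDomain σ := by
  ext i
  rw [WSent.lengths_apply, Finsupp.equivMapDomain_apply, Finsupp.equivMapDomain_apply,
    WSent.lengths_apply]

theorem Word.length_injective [Subsingleton A] : Function.Injective (Word.length (A := A)) :=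
  fun _ _ h => Word.ext (list_eq_of_length_eq h)

theorem WSent.lengths_injective [Subsingleton A] :
    Function.Injective (WSent.lengths (A := A)) := fun _ _ h =>
  Finsupp.ext fun i => list_eq_of_length_eq (DFunLike.congr_fun h i)

variable [LinearOrder A]

theorem PSent.nodup_boxes_map_fst (P : PSent A) : (P.boxes.map Prod.fst).Nodup := by
  rw [PSent.boxes, List.map_flatMap, List.nodup_flatMap]
  have h : ∀ (B : Type _) (l : List B), l.zipIdx.Pairwise fun p q => p.2 ≠ q.2 := by
    intro B l
    rw [← List.pairwise_map (f := Prod.snd) (R := (· ≠ ·)), List.zipIdx_map_snd]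
    exact List.nodup_range'
  constructor
  · rintro ⟨w, i⟩ _
    rw [List.map_map, List.Nodup, List.pairwise_map]
    exact (h _ _).imp fun hpq he => hpq (Prod.ext_iff.1 (show (i, _) = (i, _) from he)).2
  · rw [List.pairwise_reverse]
    refine (h _ _).imp fun hpq => ?_
    rw [Function.onFun, List.disjoint_left]
    intro c h1 h2
    simp only [List.map_map, List.mem_map, Function.comp_apply] at h1 h2
    obtain ⟨_, _, rfl⟩ := h1
    obtain ⟨_, _, h3⟩ := h2
    exact hpq (Prod.ext_iff.1 h3).1

theorem PSent.toFinset_boxes_map_fst (P : PSent A) :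
    (P.boxes.map Prod.fst).toFinset = P.shape.cells := by
  ext ⟨i, j⟩
  rw [mem_cells, PSent.mem_shape, List.mem_toFinset, List.mem_map]
  constructor
  · rintro ⟨b, hb, h⟩
    exact ⟨b.2, h ▸ hb⟩
  · rintro ⟨a, ha⟩
    exact ⟨_, ha, rfl⟩

theorem PSent.card_shape (P : PSent A) : P.shape.card = P.size := by
  rw [YoungDiagram.card, ← PSent.toFinset_boxes_map_fst,
    List.toFinset_card_of_nodup P.nodup_boxes_map_fst, List.length_map, ← PSent.size_toWSent,
    ← CSSYT.type_highestWeight, CSSYT.size_type]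

theorem PSent.rowLens_shape (P : PSent A) : P.shape.rowLens = P.words.map Word.length := by
  refine YoungDiagram.rowLens_ofRowLens_eq_self fun x hx => ?_
  obtain ⟨w, -, rfl⟩ := List.mem_map.1 hx
  exact List.length_pos_iff.2 w.ne_nil

/-- Valid for any alphabet: forgetting the colors turns the type into the content. -/
theorem CSSYT.lengths_type {P : PSent A} (T : CSSYT P) :
    (CSSYT.type T).lengths = content T := by
  classical
  ext i
  have h := CSSYT.sum_type T fun x => if x = i then 1 else 0
  have h1 : (P.boxes.map fun b => if T b.1.1 b.1.2 = i then 1 else 0) =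
      (P.boxes.map Prod.fst).map fun c => if T c.1 c.2 = i then 1 else 0 := by
    rw [List.map_map]
    rfl
  rw [content_apply, card_filter, ← PSent.toFinset_boxes_map_fst,
    List.sum_toFinset _ P.nodup_boxes_map_fst, ← h1, h, WSent.lengths_apply, Finsupp.sum]
  simp only [ite_mul, one_mul, zero_mul, sum_ite_eq', Finsupp.mem_support_iff]
  split_ifs with h0
  · rfl
  · rw [not_not.1 h0]
    rfl

theorem PSent.lengths_toWSent (P : PSent A) :
    P.toWSent.lengths = (P.words.map Word.length).toFinsupp := by
  ext i
  rw [WSent.lengths_apply, PSent.toWSent, Finsupp.onFinset_apply, List.toFinsupp_apply]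
  split_ifs with h
  · rw [List.getD_eq_getElem _ _ (by rwa [List.length_map]), List.getElem_map]
    rfl
  · rw [List.getD_eq_default _ _ (by rw [List.length_map]; omega)]
    rfl

theorem PSent.shape_injective [Subsingleton A] : Function.Injective (PSent.shape (A := A)) :=
  fun P Q h => PSent.ext <| List.map_injective_iff.2 Word.length_injective <| by
    rw [← P.rowLens_shape, ← Q.rowLens_shape, h]

/-- With at most one color a weak sentence is determined by its word lengths, so fixing the type
amounts to fixing the content. -/
theorem coloredKostka_eq_kostka [Subsingleton A] (P : PSent A) (B : WSent A) :
    coloredKostka P B = kostka P.shape B.lengths :=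
  Nat.card_congr <| Equiv.subtypeEquivRight fun T => by
    rw [← CSSYT.lengths_type, WSent.lengths_injective.eq_iff]

theorem PSent.shape_surjective [Nonempty A] : Function.Surjective (PSent.shape (A := A)) := by
  intro lam
  obtain ⟨a⟩ := ‹Nonempty A›
  let w : {n : ℕ // n ∈ lam.rowLens} → Word A := fun n =>
    ⟨List.replicate n a, fun h => by
      have := lam.pos_of_mem_rowLens n n.2
      have := (List.replicate_eq_nil_iff _).1 h
      omega⟩
  have hw : ∀ n, (w n).length = n := fun n => List.length_replicate
  -- The graded order compares lengths first, so constant words are ordered like their lengths.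
  have hmono : ∀ m n, m.1 ≤ n.1 → w m ≤ w n := by
    intro m n h
    rcases h.eq_or_lt with h | h
    · rw [Subtype.ext h]
    · by_contra hlt
      have := Word.length_mono (not_le.1 hlt).le
      rw [hw, hw] at this
      omega
  refine ⟨⟨lam.rowLens.attach.map w, ?_⟩, ?_⟩
  · rw [List.sortedGE_iff_pairwise, List.pairwise_map]
    have := List.sortedGE_iff_pairwise.1 lam.rowLens_sorted
    rw [← List.attach_map_subtype_val lam.rowLens, List.pairwise_map] at this
    exact this.imp fun h => hmono _ _ h
  · refine YoungDiagram.equivListRowLens.injective (Subtype.ext ?_)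
    change (PSent.shape _).rowLens = lam.rowLens
    rw [PSent.rowLens_shape, List.map_map]
    conv_rhs => rw [← List.attach_map_subtype_val lam.rowLens]
    exact List.map_congr_left fun n _ => hw n

/-! ### The uncoloring maps on colored Schur and dual Schur functions -/

theorem uncolorPSymA_completeA (P : PSent A) :
    uncolorPSymA A (completeA P) = completeSymPart P.shape := by
  rw [← completeBasis_apply, uncolorPSymA, Module.Basis.constr_basis]

/-- In one color the multiset of nonempty words and the multiset of their lengths carry the same
information. -/
theorem coeff_monomialSym_shape [Subsingleton A] (P : PSent A) (K : WSent A)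
    [Decidable (P = K.sort)] :
    MvPowerSeries.coeff K.lengths (monomialSym P.shape : MvPowerSeries ℕ ℚ) =
      if P = K.sort then 1 else 0 := by
  classical
  change (if K.lengths.support.val.map K.lengths = (P.shape.rowLens : Multiset ℕ) then (1 : ℚ)
    else 0) = _
  refine if_congr ?_ rfl rfl
  rw [← WSent.map_length_words, PSent.rowLens_shape, ← Multiset.map_coe,
    (Multiset.map_injective Word.length_injective).eq_iff, WSent.sort]
  constructor
  · intro h
    rw [h, PSent.ofMultiset_coe]
  · rintro h
    rw [h, PSent.coe_ofMultiset]

variable [Finite A]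

theorem eq_of_pairing_coloredDualSchur {f g : PSymA A}
    (h : ∀ Q : PSent A, pairing A f (coloredDualSchur Q) = pairing A g (coloredDualSchur Q)) :
    f = g := by
  -- Any p-sentence would serve: adding `f - g` to its colored Schur function leaves all pairings
  -- unchanged, so uniqueness gives `f - g = 0`.
  let P : PSent A := ⟨[], List.sortedGE_iff_pairwise.2 .nil⟩
  have h1 := (existsUnique_coloredSchur P).unique (pairing_coloredSchur P)
    (y₂ := coloredSchur P + (f - g)) fun Q => by
      rw [map_add, map_sub, LinearMap.add_apply, LinearMap.sub_apply, h Q, sub_self, add_zero,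
        pairing_coloredSchur]
  rwa [left_eq_add, sub_eq_zero] at h1

/-- By duality the coefficient of `s_R` in `h_P` is `⟨h_P, s*_R⟩`, a colored Kostka number. -/
theorem completeA_eq_sum_coloredSchur (P : PSent A) :
    completeA P = ∑ R ∈ (finite_coloredKostka_left P).toFinset,
      (coloredKostka R P.toWSent : ℚ) • coloredSchur R := by
  classical
  refine eq_of_pairing_coloredDualSchur fun Q => ?_
  rw [pairing_completeA_coloredDualSchur, map_sum, LinearMap.sum_apply]
  simp only [map_smul, LinearMap.smul_apply, pairing_coloredSchur, smul_eq_mul, mul_ite, mul_one,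
    mul_zero, sum_ite_eq', Set.Finite.mem_toFinset, Set.mem_ofPred_eq]
  split_ifs with h
  · rfl
  · rw [not_not.1 h, Nat.cast_zero]

theorem uncolorSymA_monomialA (P : PSent A) :
    uncolorSymA A (monomialA P) = monomialSym P.shape := by
  rw [← monomialBasis_apply, uncolorSymA, Module.Basis.constr_basis]

theorem completeSymPart_shape [Subsingleton A] [Nonempty A] (P : PSent A) :
    (completeSymPart P.shape : MvPowerSeries ℕ ℚ) =
      ∑ R ∈ (finite_coloredKostka_left P).toFinset,
        (coloredKostka R P.toWSent : ℚ) • schur R.shape := by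
  rw [completeSymPart, PSent.rowLens_shape, prod_completeSym]
  symm
  refine sum_of_injOn PSent.shape PSent.shape_injective.injOn ?_ ?_ ?_
  · intro R hR
    rw [Set.Finite.coe_toFinset] at hR
    rw [mem_coe, mem_ofCard, PSent.card_shape, ← size_eq_of_coloredKostka_ne_zero hR]
    rfl
  -- Every partition is the shape of a p-sentence, so those missed by the sum have Kostka number
  -- zero.
  · intro lam _ h
    obtain ⟨R, rfl⟩ := PSent.shape_surjective (A := A) lam
    have : coloredKostka R P.toWSent = 0 := by
      by_contra h0
      exact h ⟨R, by rwa [Set.Finite.coe_toFinset], rfl⟩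
    rw [← PSent.lengths_toWSent, ← coloredKostka_eq_kostka, this, Nat.cast_zero, zero_smul]
  · intro R _
    rw [← PSent.lengths_toWSent, ← coloredKostka_eq_kostka]

/-- The two expansions of `h_P` have equal coefficients, with `1` at `R = P`. All other `R` have
smaller rank, so by induction their terms cancel. -/
theorem uncolorPSymA_coloredSchur [Subsingleton A] [Nonempty A] (P : PSent A) :
    (uncolorPSymA A (coloredSchur P) : MvPowerSeries ℕ ℚ) = schur P.shape := by
  classical
  induction h : P.rank using Nat.strong_induction_on generalizing P with
  | _ n ih =>
    subst h
    have hP : P ∈ (finite_coloredKostka_left P).toFinset := by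
      rw [Set.Finite.mem_toFinset, Set.mem_ofPred_eq, coloredKostka_self]
      exact one_ne_zero
    have h1 := congrArg (fun f => (uncolorPSymA A f : MvPowerSeries ℕ ℚ))
      (completeA_eq_sum_coloredSchur P)
    rw [uncolorPSymA_completeA, completeSymPart_shape, map_sum, ← Subalgebra.coe_val, map_sum,
      ← add_sum_erase _ _ hP, ← add_sum_erase _ _ hP, coloredKostka_self, Nat.cast_one, one_smul,
      one_smul] at h1
    rw [sum_congr rfl fun R hR => ?_] at h1
    · exact (add_right_cancel h1).symm
    · rw [mem_erase, Set.Finite.mem_toFinset] at hR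
      rw [map_smul, map_smul, Subalgebra.coe_val,
        ih _ ((coloredKostka_triangular hR.2).resolve_right hR.1) R rfl]

theorem uncolorSymA_coloredDualSchur [Subsingleton A] [Nonempty A] (P : PSent A) :
    (uncolorSymA A (coloredDualSchur P) : MvPowerSeries ℕ ℚ) = schur P.shape := by
  classical
  obtain ⟨a⟩ := ‹Nonempty A›
  have h1 : coloredDualSchur P = ∑ Q ∈ (finite_coloredKostka P).toFinset,
      (coloredKostka P Q.toWSent : ℚ) • monomialA Q := by
    refine finsum_eq_sum_of_support_subset _ fun Q hQ => ?_
    rw [Set.Finite.coe_toFinset]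
    intro h0
    refine hQ ?_
    simp only [h0, Nat.cast_zero, zero_smul]
  ext α
  -- Every exponent arises from a weak sentence in one color, so coefficients can be compared
  -- through sorting.
  obtain ⟨K, rfl⟩ : ∃ K : WSent A, K.lengths = α := ⟨_, WSent.lengths_ofLengths a α⟩
  obtain ⟨σ, hσ⟩ := WSent.exists_perm (K := K) (L := K.sort.toWSent) (by rw [PSent.sort_toWSent])
  rw [h1, map_sum, ← Subalgebra.coe_val, map_sum, map_sum]
  simp only [map_smul, uncolorSymA_monomialA, Subalgebra.coe_val,
    coeff_monomialSym_shape, smul_eq_mul, mul_ite, mul_one, mul_zero, sum_ite_eq',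
    Set.Finite.mem_toFinset, Set.mem_ofPred_eq]
  -- Invariance of Kostka numbers under permuting the content: the Schur function equals an
  -- uncolored `s_P`, which is symmetric by the definition of `Sym`.
  have h2 : (coloredKostka P K.sort.toWSent : ℚ) =
      MvPowerSeries.coeff K.lengths (schur P.shape) := by
    rw [coloredKostka_eq_kostka, hσ, WSent.lengths_equivMapDomain, ← coeff_schur,
      ← uncolorPSymA_coloredSchur]
    exact (uncolorPSymA A (coloredSchur P)).2.1 σ K.lengths
  rw [← h2]
  split_ifs with h
  · rfl
  · rw [not_not.1 h, Nat.cast_zero]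

end ColoredSym

theorem mainTheorem9 {A : Type*} [LinearOrder A] [Finite A] (hA : Nat.card A = 1)
    (P Q : ColoredSym.PSent A) :
    (ColoredSym.uncolorSymA A (ColoredSym.coloredDualSchur P) : MvPowerSeries ℕ ℚ) =
        ColoredSym.schur P.shape ∧
      (ColoredSym.uncolorPSymA A (ColoredSym.coloredSchur Q) : MvPowerSeries ℕ ℚ) =
        ColoredSym.schur Q.shape := by
  obtain ⟨_, _⟩ := Nat.card_eq_one_iff_unique.1 hA
  exact ⟨ColoredSym.uncolorSymA_coloredDualSchur P, ColoredSym.uncolorPSymA_coloredSchur Q⟩
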